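/- Let $n\ge 0$ and put $x_0:=0$ for $x=(x_1,\dots,x_n)\in\mathbb{R}^n$. Let $\mathcal{A}_n$ be the arrangement of all hyperplanes $H_{i,j}^l=\{x\in\mathbb{R}^n : x_i-x_j=l\}$ with $i\neq j$ in $\{0,1,\dots,n\}$ and $l\in\mathbb{Z}$. Call a polytope $P\subset\mathbb{R}^n$ alcoved if all its facet-defining hyperplanes belong to $\mathcal{A}_n$ (such a $P$ is full-dimensional) or, allowing lower dimension, if $P=\{x\in\mathbb{R}^n : a_{ij}\le x_i-x_j\le b_{ij}\text{ for all } i,j\in\{0,\dots,n\}\}$ for some integers $a_{ij},b_{ij}$. Let $P$ be a nonempty alcoved polytope of dimension $d$. Its alcoved triangulation $\Delta$ is the set of $d$-simplices into which $\mathcal{A}_n$ subdivides $P$, that is, the closures of the $d$-dimensional relatively open cells of $\mathcal{A}_n$ whose closure is contained in $P$. The dual graph $G_\Delta$ has vertex set $\Delta$, and distinct $F,F'\in\Delta$ are adjacent if and only if $F\cap F'$ is a facet of both. Fix $F_0\in\Delta$ and let $D_\Delta(F_0)$ be the orientation of $G_\Delta$ away from $F_0$: an edge $\{F,F'\}$ is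 oriented as the arc $(F,F')$ if and only if $d(F_0,F')=d(F_0,F)+1$, where $d(\cdot,\cdot)$ is the distance in $G_\Delta$. For integers $t\ge 0$ let $L_P(t)=\#(tP\cap\mathbb{Z}^n)$, and define $h_k^*(P)$ for $k\ge 0$ by $$\sum_{k\ge 0}h_k^*(P)\,z^k=(1-z)^{d+1}\sum_{t\ge 0}L_P(t)\,z^t .$$ Then $\Delta$ is finite and, for every $k\ge 0$, $$h_k^*(P)=\#\left\{F\in\Delta \;\middle|\; F\text{ has exactly }k\text{ incoming arcs in }D_\Delta(F_0)\right\}.$$ -/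

import Mathlib

open scoped Pointwise

namespace Alcoved

/-- The dimension of (the affine hull of) a set in `ℝⁿ`; the empty set has dimension `-1`. -/
noncomputable def polyDim {n : ℕ} (S : Set (Fin n → ℝ)) : ℤ :=
  open scoped Classical in
  if S.Nonempty then (Module.finrank ℝ (vectorSpan ℝ S) : ℤ) else -1

/-- A polytope in `ℝⁿ` is the convex hull of a finite set of points. -/
def IsPolytope {n : ℕ} (P : Set (Fin n → ℝ)) : Prop :=
  ∃ V : Set (Fin n → ℝ), V.Finite ∧ P = convexHull ℝ V

/-- The coordinates `x₀, x₁, …, xₙ` of a point `x` of `ℝⁿ`, where `x₀ = 0`. -/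
def coord {n : ℕ} (x : Fin n → ℝ) : Fin (n + 1) → ℝ :=
  Fin.cons 0 x

/-- The set `H_{i,j}^l = {x ∈ ℝⁿ | x_i - x_j = l}`. The arrangement `𝒜ₙ` consists of the sets
`hyp i j l` with `i ≠ j` in `{0, 1, …, n}` and `l ∈ ℤ`. -/
def hyp {n : ℕ} (i j : Fin (n + 1)) (l : ℤ) : Set (Fin n → ℝ) :=
  {x | coord x i - coord x j = l}

/-- `H` is a hyperplane `a₁x₁ + ⋯ + aₙxₙ = b` that has all of `P` on one of its sides. -/
def IsDefiningHyperplane {n : ℕ} (P H : Set (Fin n → ℝ)) : Prop :=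
  ∃ (a : Fin n → ℝ) (b : ℝ), a ≠ 0 ∧ H = {x | a ⬝ᵥ x = b} ∧
    ((∀ x ∈ P, a ⬝ᵥ x ≤ b) ∨ (∀ x ∈ P, b ≤ a ⬝ᵥ x))

/-- `H` is a defining hyperplane of `P` that cuts out a facet of `P`. -/
def IsFacetDefining {n : ℕ} (P H : Set (Fin n → ℝ)) : Prop :=
  IsDefiningHyperplane P H ∧ polyDim (H ∩ P) = polyDim P - 1

/-- Alcoved polytopes. The first alternative, all facet-defining hyperplanes belong to `𝒜ₙ`,
can only hold for full-dimensional polytopes (a facet of a lower-dimensional polytope is cut out by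
infinitely many hyperplanes). The second one, the description by inequalities
`a i j ≤ x_i - x_j ≤ b i j` with integral bounds, also admits polytopes of lower dimension. -/
def IsAlcovedPolytope {n : ℕ} (P : Set (Fin n → ℝ)) : Prop :=
  IsPolytope P ∧
    ((∀ H, IsFacetDefining P H → ∃ (i j : Fin (n + 1)) (l : ℤ), i ≠ j ∧ H = hyp i j l) ∨
      ∃ a b : Fin (n + 1) → Fin (n + 1) → ℤ,
        P = {x | ∀ i j, (a i j : ℝ) ≤ coord x i - coord x j ∧ coord x i - coord x j ≤ b i j})

/-- The relatively open cell of the arrangement `𝒜ₙ` that contains `x`: the points lying on the same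
side of, or on, every hyperplane `x_i - x_j = l`, as `x` does. -/
def cell {n : ℕ} (x : Fin n → ℝ) : Set (Fin n → ℝ) :=
  {y | ∀ (i j : Fin (n + 1)) (l : ℤ), i ≠ j →
    SignType.sign (coord y i - coord y j - l) = SignType.sign (coord x i - coord x j - l)}

/-- The (maximal simplices of the) alcoved triangulation of `P`: the closed cells of `𝒜ₙ` that are
contained in `P` and have the dimension of `P`. If `P` is full-dimensional, these are the closures
of the regions of `𝒜ₙ` that are contained in `P`. -/
def alcovedTriangulation {n : ℕ} (P : Set (Fin n → ℝ)) : Set (Set (Fin n → ℝ)) :=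
  {F | ∃ x, F = closure (cell x) ∧ F ⊆ P ∧ polyDim F = polyDim P}

/-- `G` is a facet of `F`: a face of dimension `dim F - 1`. -/
def IsFacet {n : ℕ} (G F : Set (Fin n → ℝ)) : Prop :=
  IsExposed ℝ F G ∧ polyDim G = polyDim F - 1

/-- The dual graph of a set `Δ` of simplices: `F` and `F'` are adjacent when `F ∩ F'` is a facet
of both. -/
def dualGraph {n : ℕ} (Δ : Set (Set (Fin n → ℝ))) : SimpleGraph Δ where
  Adj F F' := F ≠ F' ∧ IsFacet ((F : Set (Fin n → ℝ)) ∩ F') F ∧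
    IsFacet ((F : Set (Fin n → ℝ)) ∩ F') F'
  symm := ⟨fun F F' h => ⟨h.1.symm, by rw [Set.inter_comm]; exact h.2.2, by
    rw [Set.inter_comm]; exact h.2.1⟩⟩
  loopless := ⟨fun _ h => h.1 rfl⟩

/-- The orientation of a graph away from `v₀`: an edge between `u` and `v` becomes the arc `(u, v)`
if and only if `d(v₀, v) = d(v₀, u) + 1`. -/
def orientAway {V : Type*} (G : SimpleGraph V) (v₀ : V) : Digraph V where
  Adj u v := G.Adj u v ∧ G.dist v₀ v = G.dist v₀ u + 1

/-- `L_P(t)`, the number of integer points of the dilate `tP`. -/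
noncomputable def latticeCount {n : ℕ} (P : Set (Fin n → ℝ)) (t : ℕ) : ℕ :=
  {z : Fin n → ℤ | (fun i => (z i : ℝ)) ∈ (t : ℝ) • P}.ncard

/-- The Ehrhart series `∑_{t ≥ 0} L_P(t) z^t`. -/
noncomputable def ehrhartSeries {n : ℕ} (P : Set (Fin n → ℝ)) : PowerSeries ℤ :=
  PowerSeries.mk fun t => (latticeCount P t : ℤ)

/-- `h*_k(P)`, the coefficient of `z^k` in `(1 - z)^(d+1) ∑_{t ≥ 0} L_P(t) z^t`, `d = dim P`. -/
noncomputable def hStar {n : ℕ} (P : Set (Fin n → ℝ)) (k : ℕ) : ℤ :=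
  PowerSeries.coeff k ((1 - PowerSeries.X) ^ (polyDim P + 1).toNat * ehrhartSeries P)

end Alcoved

/-! The proof is a half-open decomposition of `P`. Fix a point `q` in the relative interior of `F₀`
that lies on no hyperplane of the arrangement except those containing `P`. From every simplex of `Δ`
remove the facets visible from `q`, that is, those whose hyperplane separates the simplex from `q`.
The remaining half-open simplices partition `P`. They are unimodular, so one with `v` removed facets
has lattice point series `z^v / (1 - z)^(d+1)` (`one_sub_X_pow_mul_weights`). Hence `h*_k` counts
the simplices with `k` visible facets. Only the lattice points of dilates are needed:
`latticeCount_alc` moves `z ∈ tP` to `(z + ε q) / (t + ε)`, which lies in exactly one open simplex.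
Since the barycentric coordinates of `z` are integers, positivity for the moved point says that they
are nonnegative, and at least one at visible facets.

Visible facets are incoming arcs (`encard_incoming`). The distance in the dual graph is the number
of separating hyperplanes (`two_mul_dist_dualGraph`): each edge crosses one hyperplane, and a
simplex other than `F₀` has a visible facet. The neighbour behind a visible facet still lies in `P`,
because `q ∈ P` satisfies the inequalities that could fail there (`exists_isFlip`).

Cells are encoded by the integers `⌊x_i - x_j⌋`. To cover all dimensions, indices whose coordinate
difference is constant on `P` form one of `d + 1` classes. Sorting the fractional parts of the
coordinates arranges the classes cyclically; the gaps between neighbours are the barycentric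
coordinates (`Chart.lam`), and adjacent simplices differ by exchanging two neighbours (`IsFlip`).

Both kinds of alcoved polytopes reduce to sets `alc b` (`exists_eq_alc`). Under the facet condition,
a polytope that is not full-dimensional would have uncountably many facet-defining hyperplanes,
while the arrangement is countable; in full dimension, facets separate every outside point. -/

namespace Alcoved

/-! ### Coordinate differences and the cells of the arrangement -/

section Basic

variable {n : ℕ}

/-- The coordinate difference `x_i - x_j`. -/
def dif (x : Fin n → ℝ) (i j : Fin (n + 1)) : ℝ := coord x i - coord x j

/-- The integral part of the coordinate difference `x_i - x_j`. -/
noncomputable def fl (x : Fin n → ℝ) (i j : Fin (n + 1)) : ℤ := ⌊dif x i j⌋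

/-- The set cut out by the inequalities `x_i - x_j ≤ b i j`. -/
def alc (b : Fin (n + 1) → Fin (n + 1) → ℤ) : Set (Fin n → ℝ) :=
  {x | ∀ i j, dif x i j ≤ b i j}

/-- The point of `ℝⁿ` with homogeneous coordinates `Y` (modulo the all-ones vector). -/
def pt (Y : Fin (n + 1) → ℝ) : Fin n → ℝ := fun i => Y i.succ - Y 0

@[simp] lemma coord_zero (x : Fin n → ℝ) : coord x 0 = 0 := rfl

@[simp] lemma coord_succ (x : Fin n → ℝ) (i : Fin n) : coord x i.succ = x i := rfl

@[simp] lemma coord_pt (Y : Fin (n + 1) → ℝ) (i : Fin (n + 1)) : coord (pt Y) i = Y i - Y 0 := by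
  refine Fin.cases ?_ (fun i => ?_) i <;> simp [pt]

lemma dif_pt (Y : Fin (n + 1) → ℝ) (i j : Fin (n + 1)) : dif (pt Y) i j = Y i - Y j := by
  simp [dif]

lemma coord_add (x y : Fin n → ℝ) (i : Fin (n + 1)) : coord (x + y) i = coord x i + coord y i := by
  refine Fin.cases ?_ (fun i => ?_) i <;> simp

lemma coord_smul (a : ℝ) (x : Fin n → ℝ) (i : Fin (n + 1)) : coord (a • x) i = a * coord x i := by
  refine Fin.cases ?_ (fun i => ?_) i <;> simp

lemma coord_sub (x y : Fin n → ℝ) (i : Fin (n + 1)) : coord (x - y) i = coord x i - coord y i := by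
  refine Fin.cases ?_ (fun i => ?_) i <;> simp

lemma dif_add (x y : Fin n → ℝ) (i j : Fin (n + 1)) : dif (x + y) i j = dif x i j + dif y i j := by
  simp only [dif, coord_add]; ring

lemma dif_smul (a : ℝ) (x : Fin n → ℝ) (i j : Fin (n + 1)) : dif (a • x) i j = a * dif x i j := by
  simp only [dif, coord_smul]; ring

lemma dif_sub (x y : Fin n → ℝ) (i j : Fin (n + 1)) : dif (x - y) i j = dif x i j - dif y i j := by
  simp only [dif, coord_sub]; ring

lemma dif_comm (x : Fin n → ℝ) (i j : Fin (n + 1)) : dif x i j = -dif x j i := by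
  simp [dif]

lemma dif_self (x : Fin n → ℝ) (i : Fin (n + 1)) : dif x i i = 0 := by simp [dif]

lemma dif_add_dif (x : Fin n → ℝ) (i j k : Fin (n + 1)) : dif x i j + dif x j k = dif x i k := by
  simp [dif]

lemma dif_zero (x : Fin n → ℝ) (i : Fin n) : dif x i.succ 0 = x i := by simp [dif]

lemma ext_dif {x y : Fin n → ℝ} (h : ∀ i j, dif x i j = dif y i j) : x = y := by
  funext i
  simpa [dif] using h i.succ 0

lemma continuous_coord (i : Fin (n + 1)) : Continuous fun x : Fin n → ℝ => coord x i := by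
  refine Fin.cases ?_ (fun i => ?_) i
  · simpa using continuous_const
  · simpa using continuous_apply i

lemma continuous_dif (i j : Fin (n + 1)) : Continuous fun x : Fin n → ℝ => dif x i j :=
  (continuous_coord i).sub (continuous_coord j)

lemma isClosed_alc (b : Fin (n + 1) → Fin (n + 1) → ℤ) : IsClosed (alc b) := by
  simp only [alc, Set.ofPred_forall]
  exact isClosed_iInter fun i => isClosed_iInter fun j =>
    isClosed_le (continuous_dif i j) continuous_const

lemma fl_le (x : Fin n → ℝ) (i j : Fin (n + 1)) : (fl x i j : ℝ) ≤ dif x i j := Int.floor_le _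

lemma lt_fl (x : Fin n → ℝ) (i j : Fin (n + 1)) : dif x i j < fl x i j + 1 := Int.lt_floor_add_one _

lemma le_fl {x : Fin n → ℝ} {i j : Fin (n + 1)} {l : ℤ} : l ≤ fl x i j ↔ (l : ℝ) ≤ dif x i j :=
  Int.le_floor

lemma fl_eq {x : Fin n → ℝ} {i j : Fin (n + 1)} {l : ℤ} (h : (l : ℝ) ≤ dif x i j)
    (h' : dif x i j < l + 1) : fl x i j = l :=
  Int.floor_eq_iff.2 ⟨h, h'⟩

lemma fl_lt {x : Fin n → ℝ} {i j : Fin (n + 1)} {l : ℤ} : fl x i j < l ↔ dif x i j < l :=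
  Int.floor_lt

lemma fl_add_fl_le (x : Fin n → ℝ) (i j k : Fin (n + 1)) : fl x i j + fl x j k ≤ fl x i k := by
  rw [le_fl, ← dif_add_dif x i j k]
  push_cast
  exact add_le_add (fl_le _ _ _) (fl_le _ _ _)

lemma fl_of_dif_eq {x : Fin n → ℝ} {i j : Fin (n + 1)} {l : ℤ} (h : dif x i j = l) :
    fl x i j = l := by
  simp [fl, h]

/-- Differences that are integral are determined by the integral parts. -/
lemma dif_eq_of_fl_eq {x y : Fin n → ℝ} (h : ∀ i j, fl y i j = fl x i j) {i j : Fin (n + 1)}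
    {l : ℤ} (hl : dif x i j = l) : dif y i j = l := by
  have h1 := h i j
  have h2 : fl y j i = -l := (h j i).trans (fl_of_dif_eq (by rw [dif_comm, hl]; simp))
  rw [fl_of_dif_eq hl] at h1
  have h3 := fl_le y i j
  have h4 := fl_le y j i
  rw [h1] at h3
  rw [h2, dif_comm] at h4
  push_cast at h4
  linarith

lemma mem_cell_iff_sign {x y : Fin n → ℝ} : y ∈ cell x ↔ ∀ i j (l : ℤ),
    SignType.sign (dif y i j - l) = SignType.sign (dif x i j - l) := by
  refine ⟨fun h i j l => ?_, fun h i j l _ => h i j l⟩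
  by_cases hij : i = j
  · subst hij; simp [dif]
  · exact h i j l hij

/-- The integral parts for `(i, j)` and `(j, i)` together give floor and ceiling of `x_i - x_j`,
hence its position relative to every integer. -/
lemma mem_cell_iff {x y : Fin n → ℝ} : y ∈ cell x ↔ ∀ i j, fl y i j = fl x i j := by
  rw [mem_cell_iff_sign]
  constructor
  · have key : ∀ {x y : Fin n → ℝ} {i j}, (∀ l : ℤ,
        SignType.sign (dif y i j - l) = SignType.sign (dif x i j - l)) → fl x i j ≤ fl y i j := by
      intro x y i j h
      rw [le_fl, ← sub_nonneg, ← sign_nonneg_iff, h, sign_nonneg_iff, sub_nonneg]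
      exact fl_le _ _ _
    intro h i j
    exact le_antisymm (key fun l => (h i j l).symm) (key fun l => h i j l)
  · intro h i j l
    rcases lt_trichotomy (dif x i j) l with h1 | h1 | h1
    · have : dif y i j < l := by rw [← fl_lt, h, fl_lt]; exact h1
      rw [sign_neg (sub_neg.2 h1), sign_neg (sub_neg.2 this)]
    · rw [h1, dif_eq_of_fl_eq h h1]
    · have : dif y j i < (-l : ℤ) := by
        rw [← fl_lt, h, fl_lt, dif_comm]; push_cast; linarith
      rw [dif_comm] at this
      push_cast at this
      rw [sign_pos (sub_pos.2 h1), sign_pos (by linarith)]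

lemma self_mem_cell (x : Fin n → ℝ) : x ∈ cell x := mem_cell_iff.2 fun _ _ => rfl

lemma cell_eq_of_fl_eq {x y : Fin n → ℝ} (h : ∀ i j, fl y i j = fl x i j) : cell y = cell x := by
  ext z
  simp only [mem_cell_iff, h]

lemma mem_alc_neg_fl {x y : Fin n → ℝ} :
    y ∈ alc (fun i j => -fl x j i) ↔ ∀ i j, (fl x i j : ℝ) ≤ dif y i j := by
  constructor
  · intro h i j
    have := h j i
    rw [dif_comm] at this
    push_cast at this
    linarith
  · intro h i j
    have := h j i
    rw [dif_comm] at this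
    push_cast
    linarith

/-- If `y` satisfies the weak inequalities, the open segment from `y` to `x` lies in the cell, so
`y` is a limit of points of the cell. -/
lemma closure_cell (x : Fin n → ℝ) : closure (cell x) = alc (fun i j => -fl x j i) := by
  apply le_antisymm
  · refine closure_minimal (fun y hy => ?_) (isClosed_alc _)
    rw [mem_alc_neg_fl]
    intro i j
    rw [← mem_cell_iff.1 hy]
    exact fl_le _ _ _
  · intro y hy
    rw [mem_alc_neg_fl] at hy
    have hcont : Continuous fun s : ℝ => (1 - s) • y + s • x := by fun_prop
    have h0 : (fun s : ℝ => (1 - s) • y + s • x) 0 = y := by simp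
    have hmem : (0 : ℝ) ∈ closure (Set.Ioo (0 : ℝ) 1) := by
      rw [closure_Ioo (by norm_num)]; simp
    have := image_closure_subset_closure_image hcont ⟨0, hmem, h0⟩
    refine closure_mono ?_ this
    rintro _ ⟨s, ⟨hs0, hs1⟩, rfl⟩
    rw [mem_cell_iff]
    intro i j
    have e : dif ((1 - s) • y + s • x) i j = (1 - s) * dif y i j + s * dif x i j := by
      rw [dif_add, dif_smul, dif_smul]
    apply fl_eq
    · rw [e]; nlinarith [hy i j, fl_le x i j]
    · rw [e]
      -- The upper bound is the inequality for `(j, i)`, since `fl x j i ≥ -(fl x i j + 1)`.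
      have h1 : dif y i j ≤ fl x i j + 1 := by
        have := hy j i
        rw [dif_comm] at this
        have h2 : (-(fl x i j + 1) : ℤ) ≤ fl x j i := by
          rw [le_fl, dif_comm]; push_cast; linarith [lt_fl x i j]
        have h3 : ((-(fl x i j + 1) : ℤ) : ℝ) ≤ fl x j i := by exact_mod_cast h2
        push_cast at h3
        linarith
      nlinarith [lt_fl x i j]

lemma mem_closure_cell {x y : Fin n → ℝ} :
    y ∈ closure (cell x) ↔ ∀ i j, (fl x i j : ℝ) ≤ dif y i j := by
  rw [closure_cell, mem_alc_neg_fl]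

lemma fl_eq_of_closure_cell_eq {x y : Fin n → ℝ} (h : closure (cell x) = closure (cell y)) :
    ∀ i j, fl x i j = fl y i j := by
  have key : ∀ {x y : Fin n → ℝ}, closure (cell x) = closure (cell y) →
      ∀ i j, fl x i j ≤ fl y i j := by
    intro x y h i j
    rw [le_fl]
    exact mem_closure_cell.1 (h ▸ subset_closure (self_mem_cell y)) i j
  exact fun i j => le_antisymm (key h i j) (key h.symm i j)

/-- As the bounds `b` are integers, they hold on the whole closed cell once they hold at `x`. -/
lemma closure_cell_subset_alc {b : Fin (n + 1) → Fin (n + 1) → ℤ} {x : Fin n → ℝ} :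
    closure (cell x) ⊆ alc b ↔ x ∈ alc b := by
  refine ⟨fun h => h (subset_closure (self_mem_cell x)), fun h y hy i j => ?_⟩
  rw [mem_closure_cell] at hy
  have h1 : -b i j ≤ fl x j i := by
    rw [le_fl, dif_comm]; push_cast; linarith [h i j]
  have h2 : ((-b i j : ℤ) : ℝ) ≤ fl x j i := by exact_mod_cast h1
  have h3 := hy j i
  rw [dif_comm] at h3
  push_cast at h2
  linarith

/-- The point with coordinates `⌊x_i⌋` lies in every alcoved set that contains `x`. -/
lemma floor_mem_alc {b : Fin (n + 1) → Fin (n + 1) → ℤ} {x : Fin n → ℝ} (h : x ∈ alc b) :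
    pt (fun i => (⌊coord x i⌋ : ℝ)) ∈ alc b := by
  intro i j
  rw [dif_pt, sub_le_iff_le_add]
  have h1 : coord x i ≤ coord x j + b i j := by have := h i j; rw [dif] at this; linarith
  have h2 : ⌊coord x i⌋ ≤ ⌊coord x j⌋ + b i j := by
    rw [← Int.floor_add_intCast]; exact Int.floor_mono h1
  have : (⌊coord x i⌋ : ℝ) ≤ ⌊coord x j⌋ + b i j := by exact_mod_cast h2
  linarith

end Basic

/-! ### Dimension as a count of index classes -/

section Dimension

variable {n : ℕ} {ι : Type*}

/-- The coordinate difference as a linear functional. -/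
def difLin (i j : Fin (n + 1)) : (Fin n → ℝ) →ₗ[ℝ] ℝ where
  toFun v := dif v i j
  map_add' v w := dif_add v w i j
  map_smul' a v := dif_smul a v i j

/-- The linear map that sends a function on classes to a point whose coordinates are constant on
the classes of `h`. -/
def classMap (h : Fin (n + 1) → ι) : (ι → ℝ) →ₗ[ℝ] (Fin n → ℝ) where
  toFun w := pt fun i => w (h i)
  map_add' v w := by ext i; simp [pt]; ring
  map_smul' a v := by ext i; simp [pt]; ring

lemma dif_classMap (h : Fin (n + 1) → ι) (w : ι → ℝ) (i j : Fin (n + 1)) :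
    dif (classMap h w) i j = w (h i) - w (h j) := by
  simp [classMap, dif_pt]

lemma mem_range_classMap {h : Fin (n + 1) → ι} (hs : Function.Surjective h) {v : Fin n → ℝ}
    (hv : ∀ i j, h i = h j → dif v i j = 0) : v ∈ LinearMap.range (classMap h) := by
  refine ⟨fun c => coord v (Function.surjInv hs c), ext_dif fun i j => ?_⟩
  rw [dif_classMap]
  have h1 := hv _ _ (Function.surjInv_eq hs (h i))
  have h2 := hv _ _ (Function.surjInv_eq hs (h j))
  simp only [dif] at *
  linarith

lemma finrank_range_classMap [Fintype ι] {h : Fin (n + 1) → ι} (hs : Function.Surjective h) :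
    Module.finrank ℝ (LinearMap.range (classMap h)) + 1 = Fintype.card ι := by
  have hk : LinearMap.ker (classMap h) = Submodule.span ℝ {fun _ => (1 : ℝ)} := by
    ext w
    rw [LinearMap.mem_ker, Submodule.mem_span_singleton]
    constructor
    · intro hw
      refine ⟨w (h 0), funext fun c => ?_⟩
      obtain ⟨i, rfl⟩ := hs c
      have := dif_classMap h w i 0
      rw [hw] at this
      have h0 : dif (0 : Fin n → ℝ) i 0 = 0 := by
        have := dif_smul 0 (0 : Fin n → ℝ) i 0; simpa using this
      rw [h0] at this
      simp; linarith
    · rintro ⟨a, rfl⟩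
      ext i
      simp [classMap, pt]
  have h1 : (fun _ : ι => (1 : ℝ)) ≠ 0 := fun e => by
    have := congrFun e (h 0)
    simp at this
  have := LinearMap.finrank_range_add_finrank_ker (classMap h)
  rwa [hk, finrank_span_singleton h1, Module.finrank_fintype_fun_eq_card] at this

lemma vectorSpan_le_range_classMap {h : Fin (n + 1) → ι} (hs : Function.Surjective h)
    {S : Set (Fin n → ℝ)} (hS : ∀ i j, h i = h j → ∀ x ∈ S, ∀ y ∈ S, dif x i j = dif y i j) :
    vectorSpan ℝ S ≤ LinearMap.range (classMap h) := by
  rw [vectorSpan_def, Submodule.span_le]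
  rintro _ ⟨x, hx, y, hy, rfl⟩
  refine mem_range_classMap hs fun i j hij => ?_
  simp only [vsub_eq_sub]
  rw [dif_sub, hS i j hij x hx y hy, sub_self]

/-- Two indices are equivalent if the difference of these coordinates is constant on `S`. -/
def constDif (S : Set (Fin n → ℝ)) : Setoid (Fin (n + 1)) where
  r i j := ∀ x ∈ S, ∀ y ∈ S, dif x i j = dif y i j
  iseqv :=
    { refl := fun i x _ y _ => by rw [dif_self, dif_self]
      symm := fun h x hx y hy => by rw [dif_comm, h x hx y hy, ← dif_comm]
      trans := fun h h' x hx y hy => by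
        rw [← dif_add_dif x, h x hx y hy, h' x hx y hy, dif_add_dif] }

lemma polyDim_of_nonempty {S : Set (Fin n → ℝ)} (hS : S.Nonempty) :
    polyDim S = Module.finrank ℝ (vectorSpan ℝ S) := by
  simp [polyDim, hS]

lemma polyDim_le [Fintype ι] {h : Fin (n + 1) → ι} (hs : Function.Surjective h)
    {S : Set (Fin n → ℝ)} (hS : ∀ i j, h i = h j → ∀ x ∈ S, ∀ y ∈ S, dif x i j = dif y i j) :
    polyDim S + 1 ≤ Fintype.card ι := by
  by_cases hne : S.Nonempty
  · rw [polyDim_of_nonempty hne, ← finrank_range_classMap hs]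
    have := Submodule.finrank_mono (vectorSpan_le_range_classMap hs hS)
    push_cast
    omega
  · simp [polyDim, hne]

/-- The point `y` can be moved a little in every direction that is constant on classes: the
inequalities between classes are strict at `y`, and those inside a class are unaffected. -/
lemma polyDim_alc [Fintype ι] {h : Fin (n + 1) → ι} (hs : Function.Surjective h)
    {b : Fin (n + 1) → Fin (n + 1) → ℤ}
    (hb : ∀ i j, h i = h j → ∀ x ∈ alc b, ∀ y ∈ alc b, dif x i j = dif y i j)
    {y : Fin n → ℝ} (hy : y ∈ alc b) (hlt : ∀ i j, h i ≠ h j → dif y i j < b i j) :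
    polyDim (alc b) + 1 = Fintype.card ι := by
  refine le_antisymm (polyDim_le hs hb) ?_
  rw [polyDim_of_nonempty ⟨y, hy⟩, ← finrank_range_classMap hs]
  have : LinearMap.range (classMap h) ≤ vectorSpan ℝ (alc b) := by
    rintro _ ⟨w, rfl⟩
    set v := classMap h w with hv
    have hev : ∀ᶠ e in nhdsWithin (0 : ℝ) (Set.Ioi 0), y + e • v ∈ alc b := by
      simp only [alc, Set.mem_ofPred_eq, Filter.eventually_all]
      intro i j
      have hc : Continuous fun e : ℝ => dif (y + e • v) i j := by
        simp only [dif_add, dif_smul]; fun_prop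
      by_cases hij : h i = h j
      · refine Filter.Eventually.of_forall fun e => ?_
        rw [dif_add, dif_smul, hv, dif_classMap, hij]
        simpa using hy i j
      · have h0 : dif (y + (0 : ℝ) • v) i j < b i j := by simpa using hlt i j hij
        exact ((hc.tendsto 0).eventually_le_const h0).filter_mono nhdsWithin_le_nhds
    obtain ⟨e, he, hpos⟩ := (hev.and self_mem_nhdsWithin).exists
    have h1 := vsub_mem_vectorSpan ℝ he hy
    have h2 := (vectorSpan ℝ (alc b)).smul_mem e⁻¹ h1
    have hpos' : e ≠ 0 := ne_of_gt hpos
    simpa [smul_smul, hpos'] using h2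
  have := Submodule.finrank_mono this
  push_cast
  omega

/-- The map that identifies `c₁` with `c₀`. -/
def mergeMap [DecidableEq ι] (c₀ c₁ : ι) (h : c₀ ≠ c₁) (c : ι) : {c : ι // c ≠ c₁} :=
  if hc : c = c₁ then ⟨c₀, h⟩ else ⟨c, hc⟩

lemma mergeMap_surjective [DecidableEq ι] {c₀ c₁ : ι} (h : c₀ ≠ c₁) :
    Function.Surjective (mergeMap c₀ c₁ h) := fun c => ⟨c, by rw [mergeMap, dif_neg c.2]⟩

lemma mergeMap_eq_iff [DecidableEq ι] {c₀ c₁ : ι} (h : c₀ ≠ c₁) {c c' : ι} :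
    mergeMap c₀ c₁ h c = mergeMap c₀ c₁ h c' ↔
      c = c' ∨ (c = c₀ ∧ c' = c₁) ∨ (c = c₁ ∧ c' = c₀) := by
  unfold mergeMap
  split_ifs with h1 h2 h2 <;> simp only [Subtype.mk.injEq] <;> grind

lemma constDif_of_mergeMap [DecidableEq ι] {h : Fin (n + 1) → ι} {S : Set (Fin n → ℝ)}
    (hS : ∀ i j, h i = h j → constDif S i j) {a c : Fin (n + 1)} (hac : h a ≠ h c)
    (hconst : constDif S a c) {i j : Fin (n + 1)}
    (hij : mergeMap (h a) (h c) hac (h i) = mergeMap (h a) (h c) hac (h j)) :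
    constDif S i j := by
  rcases (mergeMap_eq_iff hac).1 hij with h1 | ⟨h1, h2⟩ | ⟨h1, h2⟩
  · exact hS i j h1
  · exact (constDif S).trans (hS i a h1) ((constDif S).trans hconst (hS c j h2.symm))
  · exact (constDif S).trans (hS i c h1)
      ((constDif S).trans ((constDif S).symm hconst) (hS a j h2.symm))

lemma card_ne [Fintype ι] [DecidableEq ι] (c₁ : ι) :
    Fintype.card {c : ι // c ≠ c₁} + 1 = Fintype.card ι := by
  have h1 : Fintype.card {c : ι // c ≠ c₁} = Fintype.card ι - 1 := Set.card_ne_eq c₁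
  have h2 : 0 < Fintype.card ι := Fintype.card_pos_iff.2 ⟨c₁⟩
  omega

/-- One more constant difference merges two classes and costs one dimension. -/
lemma polyDim_add_two_le [Fintype ι] [DecidableEq ι] {h : Fin (n + 1) → ι}
    (hs : Function.Surjective h) {S : Set (Fin n → ℝ)} (hS : ∀ i j, h i = h j → constDif S i j)
    {a c : Fin (n + 1)} (hac : h a ≠ h c) (hconst : constDif S a c) :
    polyDim S + 2 ≤ Fintype.card ι := by
  have h1 := polyDim_le (h := mergeMap (h a) (h c) hac ∘ h) (S := S)
    ((mergeMap_surjective hac).comp hs) fun i j hij => constDif_of_mergeMap hS hac hconst hij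
  rw [← card_ne (h c)]
  push_cast
  omega

end Dimension

/-! ### Regular points and the simplices containing them -/

section Regular

variable {n : ℕ} {b : Fin (n + 1) → Fin (n + 1) → ℤ}

/-- Two indices are equivalent if the difference of these coordinates is constant on `alc b`. -/
def eqv (b : Fin (n + 1) → Fin (n + 1) → ℤ) : Setoid (Fin (n + 1)) := constDif (alc b)

/-- The classes of indices with constant coordinate differences on `alc b`. -/
abbrev Cls (b : Fin (n + 1) → Fin (n + 1) → ℤ) : Type := Quotient (eqv b)

/-- The class of an index. -/
abbrev cls (b : Fin (n + 1) → Fin (n + 1) → ℤ) (i : Fin (n + 1)) : Cls b := Quotient.mk (eqv b) i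

noncomputable instance : Fintype (Cls b) :=
  @Quotient.fintype _ _ (eqv b) (Classical.decRel _)

noncomputable instance : DecidableEq (Cls b) := Classical.decEq _

lemma cls_surjective : Function.Surjective (cls b) := Quotient.mk_surjective

lemma cls_eq {i j : Fin (n + 1)} :
    cls b i = cls b j ↔ ∀ x ∈ alc b, ∀ y ∈ alc b, dif x i j = dif y i j :=
  Quotient.eq

/-- A point of `alc b` lying on no hyperplane of the arrangement except those containing
`alc b`. -/
def IsReg (b : Fin (n + 1) → Fin (n + 1) → ℤ) (x : Fin n → ℝ) : Prop :=
  x ∈ alc b ∧ ∀ i j (l : ℤ), dif x i j = l → cls b i = cls b j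

/-- `floor_mem_alc` provides an integral point of `alc b`, so a difference that is constant there is
an integer. -/
lemma dif_eq_fl {x : Fin n → ℝ} (hx : x ∈ alc b) {i j : Fin (n + 1)} (h : cls b i = cls b j) :
    dif x i j = fl x i j := by
  have h1 := cls_eq.1 h _ (floor_mem_alc hx) x hx
  rw [dif_pt] at h1
  have h2 : dif x i j = ((⌊coord x i⌋ - ⌊coord x j⌋ : ℤ) : ℝ) := by rw [← h1]; push_cast; rfl
  rw [fl_of_dif_eq h2, h2]

lemma fl_eq_of_cls_eq {x y : Fin n → ℝ} (hx : x ∈ alc b) (hy : y ∈ alc b) {i j : Fin (n + 1)}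
    (h : cls b i = cls b j) : fl x i j = fl y i j := by
  rw [fl, fl, cls_eq.1 h x hx y hy]

lemma IsReg.fl_lt_dif {x : Fin n → ℝ} (hx : IsReg b x) {i j : Fin (n + 1)}
    (h : cls b i ≠ cls b j) : (fl x i j : ℝ) < dif x i j :=
  lt_of_le_of_ne (fl_le _ _ _) fun e => h (hx.2 i j _ e.symm)

lemma IsReg.fl_comm {x : Fin n → ℝ} (hx : IsReg b x) {i j : Fin (n + 1)}
    (h : cls b i ≠ cls b j) : fl x i j = -fl x j i - 1 := by
  apply fl_eq
  · rw [dif_comm]; push_cast; linarith [lt_fl x j i]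
  · rw [dif_comm]; push_cast; linarith [hx.fl_lt_dif h.symm]

lemma IsReg.dif_lt {x : Fin n → ℝ} (hx : IsReg b x) {i j : Fin (n + 1)}
    (h : cls b i ≠ cls b j) : dif x i j < b i j :=
  lt_of_le_of_ne (hx.1 i j) fun e => h (hx.2 i j _ e)

lemma IsReg.polyDim_eq {x : Fin n → ℝ} (hx : IsReg b x) :
    polyDim (alc b) + 1 = Fintype.card (Cls b) :=
  polyDim_alc cls_surjective (fun _ _ h => cls_eq.1 h) hx.1 fun _ _ h => hx.dif_lt h

lemma IsReg.polyDim_closure_cell {x : Fin n → ℝ} (hx : IsReg b x) :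
    polyDim (closure (cell x)) + 1 = Fintype.card (Cls b) := by
  have hsub := closure_cell_subset_alc.2 hx.1
  rw [closure_cell] at hsub ⊢
  refine polyDim_alc (h := cls b) (y := x) cls_surjective
    (fun _ _ h y hy z hz => cls_eq.1 h y (hsub hy) z (hsub hz)) ?_ fun i j h => ?_
  · rw [mem_alc_neg_fl]; exact fun i j => fl_le _ _ _
  · rw [dif_comm]; push_cast; linarith [hx.fl_lt_dif h.symm]

/-- Equal dimensions force equal direction spaces. A difference that is integral at `x` is constant
on the closed cell, hence on `alc b`. -/
lemma exists_isReg {F : Set (Fin n → ℝ)} (hF : F ∈ alcovedTriangulation (alc b)) :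
    ∃ x, IsReg b x ∧ F = closure (cell x) := by
  obtain ⟨x, rfl, hsub, hdim⟩ := hF
  refine ⟨x, ⟨closure_cell_subset_alc.1 hsub, fun i j l hl => ?_⟩, rfl⟩
  have hne : (closure (cell x)).Nonempty := ⟨x, subset_closure (self_mem_cell x)⟩
  rw [polyDim_of_nonempty hne, polyDim_of_nonempty (hne.mono hsub)] at hdim
  have heq := Submodule.eq_of_le_of_finrank_eq (vectorSpan_mono ℝ hsub) (by exact_mod_cast hdim)
  have hle : vectorSpan ℝ (closure (cell x)) ≤ LinearMap.ker (difLin i j) := by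
    rw [vectorSpan_def, Submodule.span_le]
    rintro _ ⟨y, hy, z, hz, rfl⟩
    have key : ∀ y ∈ closure (cell x), dif y i j = l := by
      intro y hy
      rw [mem_closure_cell] at hy
      have h1 := hy i j
      have h2 := hy j i
      rw [fl_of_dif_eq hl] at h1
      rw [fl_of_dif_eq (l := -l) (by rw [dif_comm, hl]; simp), dif_comm] at h2
      push_cast at h2
      linarith
    change dif (y - z) i j = 0
    rw [dif_sub, key y hy, key z hz, sub_self]
  rw [heq] at hle
  rw [cls_eq]
  intro y hy z hz
  have : dif (y - z) i j = 0 := hle (vsub_mem_vectorSpan ℝ hy hz)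
  rw [dif_sub] at this
  linarith

lemma mem_alcovedTriangulation_iff {q : Fin n → ℝ} (hq : IsReg b q) {F : Set (Fin n → ℝ)} :
    F ∈ alcovedTriangulation (alc b) ↔ ∃ x, IsReg b x ∧ F = closure (cell x) := by
  refine ⟨exists_isReg, ?_⟩
  rintro ⟨x, hx, rfl⟩
  refine ⟨x, rfl, closure_cell_subset_alc.2 hx.1, ?_⟩
  have h1 := hx.polyDim_closure_cell
  have h2 := hq.polyDim_eq
  omega

end Regular

/-! ### Sorting fractional parts; facet inequalities of a simplex -/

section Charts

variable {n : ℕ} {b : Fin (n + 1) → Fin (n + 1) → ℤ} {d : ℕ} {x : Fin n → ℝ}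

/-- The order of the fractional parts of the coordinates of `x`, as a map `κ` from indices to
positions, together with a choice `σ` of an index in every position. -/
structure Chart (b : Fin (n + 1) → Fin (n + 1) → ℤ) (x : Fin n → ℝ) (d : ℕ) where
  κ : Fin (n + 1) → Fin (d + 1)
  σ : Fin (d + 1) → Fin (n + 1)
  κ_σ : ∀ k, κ (σ k) = k
  κ_eq : ∀ {i j}, κ i = κ j ↔ cls b i = cls b j
  κ_lt : ∀ {i j}, κ i < κ j ↔ Int.fract (coord x i) < Int.fract (coord x j)

/-- By regularity, fractional parts agree exactly within a class. So they take `d + 1` values, whose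
ranks are the positions. -/
lemma IsReg.nonempty_chart (hx : IsReg b x) (hd : Fintype.card (Cls b) = d + 1) :
    Nonempty (Chart b x d) := by
  have hcls : ∀ i j, Int.fract (coord x i) = Int.fract (coord x j) ↔ cls b i = cls b j := by
    intro i j
    rw [Int.fract_eq_fract]
    exact ⟨fun ⟨z, hz⟩ => hx.2 i j z hz, fun h => ⟨_, dif_eq_fl hx.1 h⟩⟩
  let T : Finset ℝ := Finset.univ.image fun i => Int.fract (coord x i)
  have hT : T.card = d + 1 := by
    have : T = Finset.univ.image fun c : Cls b => Int.fract (coord x c.out) := by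
      ext r
      simp only [T, Finset.mem_image, Finset.mem_univ, true_and]
      constructor
      · rintro ⟨i, rfl⟩
        exact ⟨cls b i, (hcls _ _).2 (Quotient.out_eq _)⟩
      · rintro ⟨c, rfl⟩
        exact ⟨_, rfl⟩
    rw [this, Finset.card_image_of_injective, Finset.card_univ, hd]
    intro c c' h
    have := (hcls _ _).1 h
    exact (Quotient.out_eq c).symm.trans (this.trans (Quotient.out_eq c'))
  let I := T.orderIsoOfFin hT
  have hmem : ∀ i, Int.fract (coord x i) ∈ T := fun i =>
    Finset.mem_image_of_mem _ (Finset.mem_univ i)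
  let κ : Fin (n + 1) → Fin (d + 1) := fun i => I.symm ⟨_, hmem i⟩
  have hσ : ∀ k, ∃ i, κ i = k := by
    intro k
    obtain ⟨i, -, hi⟩ := Finset.mem_image.1 (I k).2
    refine ⟨i, ?_⟩
    rw [OrderIso.symm_apply_eq]
    exact Subtype.ext hi
  choose σ hσ using hσ
  refine ⟨⟨κ, σ, hσ, fun {i j} => ?_, fun {i j} => ?_⟩⟩
  · rw [← hcls, I.symm.injective.eq_iff, Subtype.mk_eq_mk]
  · rw [I.symm.lt_iff_lt, Subtype.mk_lt_mk]

namespace Chart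

variable (C : Chart b x d)

lemma κ_zero : C.κ 0 = 0 := by
  by_contra h
  have h1 : C.κ (C.σ 0) < C.κ 0 := by rw [C.κ_σ]; exact Fin.pos_of_ne_zero h
  rw [C.κ_lt] at h1
  have := Int.fract_nonneg (coord x (C.σ 0))
  simp at h1
  linarith

lemma cls_σ (i : Fin (n + 1)) : cls b (C.σ (C.κ i)) = cls b i := by
  rw [← C.κ_eq, C.κ_σ]

/-- The value of the `k`-th facet inequality of the cell of `x`, homogenized. -/
noncomputable def lam (Y : Fin (n + 1) → ℝ) (t : ℝ) (k : Fin (d + 1)) : ℝ :=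
  Y (C.σ (k + 1)) - Y (C.σ k) -
    t * (⌊coord x (C.σ (k + 1))⌋ - ⌊coord x (C.σ k)⌋) + if k = Fin.last d then t else 0

lemma lam_add_smul (Y Y' : Fin (n + 1) → ℝ) (t t' a : ℝ) (k : Fin (d + 1)) :
    C.lam (fun i => Y i + a * Y' i) (t + a * t') k = C.lam Y t k + a * C.lam Y' t' k := by
  simp only [lam]
  split_ifs <;> ring

/-- Integral parts of differences, for coordinates in the order prescribed by a chart. -/
lemma fl_of_order {y : Fin n → ℝ}
    (h1 : ∀ i j, C.κ i = C.κ j →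
      coord y i - ⌊coord x i⌋ = coord y j - ⌊coord x j⌋)
    (h2 : ∀ i j, C.κ i < C.κ j → coord y i - ⌊coord x i⌋ < coord y j - ⌊coord x j⌋)
    (h3 : ∀ i j, coord y i - ⌊coord x i⌋ < coord y j - ⌊coord x j⌋ + 1) (i j : Fin (n + 1)) :
    fl y i j = ⌊coord x i⌋ - ⌊coord x j⌋ - if C.κ i < C.κ j then 1 else 0 := by
  apply fl_eq
  · simp only [dif]
    rcases lt_trichotomy (C.κ i) (C.κ j) with h | h | h
    · rw [if_pos h]; push_cast; linarith [h3 j i]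
    · rw [if_neg h.not_lt]; push_cast; linarith [h1 i j h]
    · rw [if_neg (not_lt.2 h.le)]; push_cast; linarith [h2 j i h]
  · simp only [dif]
    rcases lt_trichotomy (C.κ i) (C.κ j) with h | h | h
    · rw [if_pos h]; push_cast; linarith [h2 i j h]
    · rw [if_neg h.not_lt]; push_cast; linarith [h1 i j h]
    · rw [if_neg (not_lt.2 h.le)]; push_cast; linarith [h3 i j]

lemma fl_eq (i j : Fin (n + 1)) :
    fl x i j = ⌊coord x i⌋ - ⌊coord x j⌋ - if C.κ i < C.κ j then 1 else 0 := by
  apply C.fl_of_order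
  · intro i j h
    have h1 : ¬C.κ i < C.κ j := h.not_lt
    have h2 : ¬C.κ j < C.κ i := h.not_gt
    rw [C.κ_lt] at h1 h2
    exact le_antisymm (not_lt.1 h2) (not_lt.1 h1)
  · exact fun i j h => C.κ_lt.1 h
  · intro i j
    have h1 := Int.fract_lt_one (coord x i)
    have h2 := Int.fract_nonneg (coord x j)
    simp only [Int.fract] at h1 h2
    linarith

lemma floor_sub_of_cls (hx : x ∈ alc b) {i j : Fin (n + 1)} (h : cls b i = cls b j) :
    (⌊coord x i⌋ : ℝ) - ⌊coord x j⌋ = dif x i j := by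
  rw [← cls_eq.1 h _ (floor_mem_alc hx) x hx, dif_pt]

/-- Only the step from the last position back to the first goes down; the summand `t` in `lam`
matches the `-1` of the integral part there. For `d = 0` there is no such step and the formula
fails. -/
lemma lam_eq_dif (hd : 0 < d) (y : Fin n → ℝ) (k : Fin (d + 1)) :
    C.lam (coord y) 1 k = dif y (C.σ (k + 1)) (C.σ k) - fl x (C.σ (k + 1)) (C.σ k) := by
  have hk : C.κ (C.σ (k + 1)) < C.κ (C.σ k) ↔ k = Fin.last d := by
    rw [C.κ_σ, C.κ_σ]
    refine Fin.lastCases ?_ (fun k => ?_) k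
    · simpa [Fin.lt_def] using hd
    · rw [Fin.coeSucc_eq_succ]
      simp [Fin.lt_def, Fin.ext_iff]
      omega
  rw [C.fl_eq, lam, dif]
  simp only [hk]
  split_ifs <;> push_cast <;> ring

lemma lam_ne_zero (hd : 0 < d) {q : Fin n → ℝ} (hq : IsReg b q) (k : Fin (d + 1)) :
    C.lam (coord q) 1 k ≠ 0 := by
  rw [C.lam_eq_dif hd]
  intro h
  have h1 := hq.2 _ _ _ (sub_eq_zero.1 h)
  rw [← C.κ_eq, C.κ_σ, C.κ_σ] at h1
  have := Fin.ext_iff.1 h1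
  revert this
  refine Fin.lastCases ?_ (fun k => ?_) k
  · simpa using hd.ne
  · rw [Fin.coeSucc_eq_succ]; simp

lemma lam_zero_dim (hd : d = 0) (Y : Fin (n + 1) → ℝ) (t : ℝ) (k : Fin (d + 1)) :
    C.lam Y t k = t := by
  subst hd
  have hsub : ∀ j j' : Fin (0 + 1), j = j' := by intro j j'; ext; omega
  have hk : k = Fin.last 0 := hsub _ _
  have hk1 : k + 1 = k := hsub _ _
  rw [lam, hk1, if_pos hk]
  ring

/-- The cell of `x` is cut out by the facet inequalities. -/
lemma mem_cell_iff (hx : IsReg b x) {y : Fin n → ℝ} : y ∈ cell x ↔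
    (∀ i j, cls b i = cls b j → dif y i j = dif x i j) ∧ ∀ k, 0 < C.lam (coord y) 1 k := by
  constructor
  · intro h
    refine ⟨fun i j hij => ?_, fun k => ?_⟩
    · rw [dif_eq_fl hx.1 hij]
      exact dif_eq_of_fl_eq (Alcoved.mem_cell_iff.1 h) (dif_eq_fl hx.1 hij)
    · rcases Nat.eq_zero_or_pos d with hd | hd
      · rw [C.lam_zero_dim hd]; exact one_pos
      · have hne : cls b (C.σ (k + 1)) ≠ cls b (C.σ k) := by
          intro e
          apply C.lam_ne_zero hd hx k
          rw [C.lam_eq_dif hd, dif_eq_fl hx.1 e, sub_self]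
        rw [C.lam_eq_dif hd, ← sign_eq_one_iff, mem_cell_iff_sign.1 h, sign_eq_one_iff, sub_pos]
        exact hx.fl_lt_dif hne
  · rintro ⟨h1, h2⟩
    rw [Alcoved.mem_cell_iff]
    -- The candidates for the fractional parts of `y`, one per position; `h1` makes them independent
    -- of the representative. The inequalities make them increasing, with total spread below one.
    let G : Fin (d + 1) → ℝ := fun k => coord y (C.σ k) - ⌊coord x (C.σ k)⌋
    have hG : ∀ i, coord y i - ⌊coord x i⌋ = G (C.κ i) := by
      intro i
      have e := (C.cls_σ i).symm
      have e1 := h1 _ _ e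
      rw [← floor_sub_of_cls hx.1 e, dif] at e1
      simp only [G]
      linarith
    have hmono : StrictMono G := by
      rw [Fin.strictMono_iff_lt_succ]
      intro k
      have := h2 k.castSucc
      rw [lam, Fin.coeSucc_eq_succ, if_neg (Fin.castSucc_lt_last k).ne] at this
      simp only [G]
      linarith
    have hlast : G (Fin.last d) < G 0 + 1 := by
      have := h2 (Fin.last d)
      rw [lam, Fin.last_add_one, if_pos rfl] at this
      simp only [G]
      linarith
    intro i j
    rw [C.fl_eq i j]
    apply C.fl_of_order
    · intro i j h; rw [hG, hG, h]
    · intro i j h; rw [hG, hG]; exact hmono h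
    · intro i j
      rw [hG, hG]
      have h3 := hmono.monotone (Fin.le_last (C.κ i))
      have h4 := hmono.monotone (Fin.zero_le (C.κ j))
      linarith

end Chart

end Charts

/-! ### Exchanging two neighbouring classes -/

section Flips

variable {n : ℕ} {b : Fin (n + 1) → Fin (n + 1) → ℤ} {d : ℕ} {x x' : Fin n → ℝ}

/-- The cells of `x` and `x'` are separated only by the hyperplane `x_c - x_a = fl x c a` (up to
hyperplanes that agree with it on `alc b`), and `x_c - x_a` is larger on the cell of `x`. -/
def IsFlip (b : Fin (n + 1) → Fin (n + 1) → ℤ) (x x' : Fin n → ℝ) (a c : Fin (n + 1)) : Prop :=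
  cls b a ≠ cls b c ∧ ∀ i j, fl x' i j = fl x i j -
    (if cls b i = cls b c ∧ cls b j = cls b a then 1 else 0) +
    (if cls b i = cls b a ∧ cls b j = cls b c then 1 else 0)

namespace IsFlip

variable {a c : Fin (n + 1)}

lemma symm (h : IsFlip b x x' a c) : IsFlip b x' x c a :=
  ⟨h.1.symm, fun i j => by rw [h.2 i j]; ring⟩

lemma fl_right (h : IsFlip b x x' a c) : fl x' c a = fl x c a - 1 := by
  rw [h.2, if_pos ⟨rfl, rfl⟩, if_neg fun e => h.1 e.1.symm]; ring

lemma fl_left (h : IsFlip b x x' a c) : fl x' a c = fl x a c + 1 := by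
  rw [h.2, if_neg fun e => h.1 e.1, if_pos ⟨rfl, rfl⟩]; ring

lemma fl_of_ne_left (h : IsFlip b x x' a c) {i j : Fin (n + 1)} (hi : cls b i ≠ cls b a)
    (hi' : cls b i ≠ cls b c) : fl x' i j = fl x i j := by
  rw [h.2, if_neg fun e => hi' e.1, if_neg fun e => hi e.1]; ring

lemma fl_of_ne_right (h : IsFlip b x x' a c) {i j : Fin (n + 1)} (hj : cls b j ≠ cls b a)
    (hj' : cls b j ≠ cls b c) : fl x' i j = fl x i j := by
  rw [h.2, if_neg fun e => hj e.2, if_neg fun e => hj' e.2]; ring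

lemma congr (h : IsFlip b x x' a c) {a' c' : Fin (n + 1)} (ha : cls b a' = cls b a)
    (hc : cls b c' = cls b c) : IsFlip b x x' a' c' := by
  unfold IsFlip
  rw [ha, hc]
  exact h

end IsFlip

lemma fl_add_fl_of_cls (hx : x ∈ alc b) {i i' : Fin (n + 1)} (h : cls b i = cls b i')
    (j : Fin (n + 1)) : fl x i j = fl x i i' + fl x i' j := by
  rw [fl, ← dif_add_dif x i i' j, dif_eq_fl hx h, Int.floor_intCast_add]
  rfl

lemma fl_add_fl_of_cls_right (hx : x ∈ alc b) {j j' : Fin (n + 1)} (h : cls b j' = cls b j)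
    (i : Fin (n + 1)) : fl x i j = fl x i j' + fl x j' j := by
  rw [fl, ← dif_add_dif x i j' j, dif_eq_fl hx h, Int.floor_add_intCast]
  rfl

/-- Differences inside a class are the same at all points of `alc b` and cancel. Hence `sep` does
not depend on the chosen representatives. -/
lemma fl_sub_fl_congr {y : Fin n → ℝ} (hx : x ∈ alc b) (hy : y ∈ alc b) {i i' j j' : Fin (n + 1)}
    (hi : cls b i = cls b i') (hj : cls b j = cls b j') :
    fl x i j - fl y i j = fl x i' j' - fl y i' j' := by
  rw [fl_add_fl_of_cls hx hi, fl_add_fl_of_cls hy hi, fl_add_fl_of_cls_right hx hj.symm i',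
    fl_add_fl_of_cls_right hy hj.symm i', fl_eq_of_cls_eq hx hy hi, fl_eq_of_cls_eq hx hy hj.symm]
  ring

/-- Twice the number of hyperplanes separating the cells of `x` and `y`, where hyperplanes that
agree on `alc b` are counted once. -/
noncomputable def sep (b : Fin (n + 1) → Fin (n + 1) → ℤ) (x y : Fin n → ℝ) : ℕ :=
  ∑ p : Cls b × Cls b, (fl x p.1.out p.2.out - fl y p.1.out p.2.out).natAbs

lemma sep_self (x : Fin n → ℝ) : sep b x x = 0 := by simp [sep]

lemma cls_out (C : Cls b) : cls b C.out = C := Quotient.out_eq C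

/-- Only the summands of the two ordered pairs formed by the classes of `a` and `c` change, each by
one. -/
lemma IsFlip.sep_add_two {q : Fin n → ℝ} {a c : Fin (n + 1)} (hq : IsReg b q) (hx : IsReg b x)
    (h : IsFlip b x x' a c) (hlt : fl q c a < fl x c a) : sep b q x' + 2 = sep b q x := by
  have key : ∀ p : Cls b × Cls b, (fl q p.1.out p.2.out - fl x p.1.out p.2.out).natAbs =
      (fl q p.1.out p.2.out - fl x' p.1.out p.2.out).natAbs +
        ((if p = (cls b c, cls b a) then 1 else 0) +
          if p = (cls b a, cls b c) then 1 else 0) := by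
    rintro ⟨C, C'⟩
    rw [h.2]
    simp only [cls_out, Prod.mk.injEq]
    by_cases h1 : C = cls b c ∧ C' = cls b a
    · have h2 : ¬(C = cls b a ∧ C' = cls b c) := fun e => h.1 (e.1.symm.trans h1.1)
      rw [if_pos h1, if_neg h2, if_pos h1, if_neg h2]
      have e := fl_sub_fl_congr hq.1 hx.1 ((cls_out C).trans h1.1) ((cls_out C').trans h1.2)
      omega
    · by_cases h2 : C = cls b a ∧ C' = cls b c
      · rw [if_neg h1, if_pos h2, if_neg h1, if_pos h2]
        have e := fl_sub_fl_congr hq.1 hx.1 ((cls_out C).trans h2.1) ((cls_out C').trans h2.2)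
        have e1 := hq.fl_comm h.1
        have e2 := hx.fl_comm h.1
        omega
      · rw [if_neg h1, if_neg h2, if_neg h1, if_neg h2]
        simp
  simp only [sep]
  rw [Finset.sum_congr rfl fun p _ => key p, Finset.sum_add_distrib, Finset.sum_add_distrib,
    Finset.sum_ite_eq', Finset.sum_ite_eq']
  simp

lemma IsFlip.sep_eq_add_two {q : Fin n → ℝ} {a c : Fin (n + 1)} (hq : IsReg b q) (hx : IsReg b x)
    (hx' : IsReg b x') (h : IsFlip b x x' a c) (hle : fl x c a ≤ fl q c a) :
    sep b q x' = sep b q x + 2 := by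
  refine (h.symm.sep_add_two hq hx' ?_).symm
  rw [h.fl_left, hq.fl_comm h.1, hx.fl_comm h.1]
  omega

lemma Chart.succ_cases {d : ℕ} (hd : 0 < d) (k : Fin (d + 1)) :
    (k < k + 1 ∧ ∀ j, j < k + 1 ↔ j ≤ k) ∨ (k = Fin.last d ∧ k + 1 = 0 ∧ k + 1 < k) := by
  refine Fin.lastCases (Or.inr ?_) (fun k => Or.inl ?_) k
  · simpa [Fin.lt_def] using hd
  · rw [Fin.coeSucc_eq_succ]
    exact ⟨Fin.castSucc_lt_succ, fun j => Fin.le_castSucc_iff.symm⟩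

lemma pos_of_cls_ne (C : Chart b x d) {i j : Fin (n + 1)} (h : cls b i ≠ cls b j) : 0 < d := by
  rcases Nat.eq_zero_or_pos d with rfl | hd
  · exact absurd (C.κ_eq.1 (by ext; omega)) h
  · exact hd

/-- Flips happen at consecutive positions. -/
lemma IsFlip.κ_eq {a c : Fin (n + 1)} (C : Chart b x d) (h : IsFlip b x x' a c) :
    C.κ c = C.κ a + 1 := by
  have hd := pos_of_cls_ne C h.1
  by_contra hne
  -- If the positions were not consecutive, the class following `a` would be untouched by the flip,
  -- and `fl_add_fl_le` for `x'` and `c, i, a` would fail.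
  set i := C.σ (C.κ a + 1) with hi
  have hκ : C.κ i = C.κ a + 1 := C.κ_σ _
  have hka : C.κ a + 1 ≠ C.κ a := by
    rcases Chart.succ_cases hd (C.κ a) with h1 | h1
    · exact h1.1.ne'
    · exact h1.2.2.ne
  have hia : cls b i ≠ cls b a := fun e => hka (hκ ▸ C.κ_eq.2 e)
  have hic : cls b i ≠ cls b c := fun e => hne (by rw [← hκ]; exact (C.κ_eq.2 e).symm)
  have hac : C.κ a ≠ C.κ c := fun e => h.1 (C.κ_eq.1 e)
  have h1 := fl_add_fl_le x' c i a
  rw [h.fl_of_ne_right hia hic, h.fl_of_ne_left hia hic, h.fl_right, C.fl_eq, C.fl_eq, C.fl_eq,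
    hκ] at h1
  rcases Chart.succ_cases hd (C.κ a) with h2 | h2
  · rw [if_neg (not_lt.2 h2.1.le)] at h1
    by_cases h3 : C.κ c < C.κ a
    · rw [if_pos h3] at h1; split_ifs at h1 <;> omega
    · have : ¬C.κ c < C.κ a + 1 := by
        rw [h2.2]
        exact fun e => h3 (lt_of_le_of_ne e hac.symm)
      rw [if_neg h3, if_neg this] at h1; omega
  · rw [h2.2.1] at h1
    have h3 : C.κ c < C.κ a := by
      rw [h2.1] at hac ⊢
      exact lt_of_le_of_ne (Fin.le_last _) hac.symm
    have h4 : ¬C.κ c < 0 := not_lt.2 (Fin.zero_le _)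
    rw [if_pos h3, if_neg h4] at h1
    split_ifs at h1 <;> omega

/-- No class lies strictly between two consecutive positions. -/
lemma Chart.fl_add_fl_of_succ (C : Chart b x d) (hd : 0 < d) {i a c : Fin (n + 1)}
    (hac : C.κ c = C.κ a + 1) (hia : cls b i ≠ cls b a) (hic : cls b i ≠ cls b c) :
    fl x i a = fl x i c + fl x c a := by
  have h1 : C.κ i ≠ C.κ a := fun e => hia (C.κ_eq.1 e)
  have h2 : C.κ i ≠ C.κ c := fun e => hic (C.κ_eq.1 e)
  rw [C.fl_eq, C.fl_eq, C.fl_eq]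
  rcases Chart.succ_cases hd (C.κ a) with h3 | h3
  · have h4 : ¬C.κ c < C.κ a := by rw [hac]; exact not_lt.2 h3.1.le
    have h5 : C.κ i < C.κ c ↔ C.κ i < C.κ a := by
      rw [hac, h3.2]; exact ⟨fun h => lt_of_le_of_ne h h1, le_of_lt⟩
    simp only [h5, if_neg h4]
    ring
  · have h4 : C.κ c < C.κ a := by rw [hac]; exact h3.2.2
    have h5 : ¬C.κ i < C.κ c := by rw [hac, h3.2.1]; exact not_lt.2 (Fin.zero_le _)
    have h6 : C.κ i < C.κ a := by
      rw [h3.1] at h1 ⊢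
      exact lt_of_le_of_ne (Fin.le_last _) h1
    rw [if_pos h4, if_neg h5, if_pos h6]
    ring

/-- Exchanging the fractional parts of the coordinates in two consecutive positions. -/
lemma exists_fl_eq_of_succ (hx : IsReg b x) (C : Chart b x d) {a c : Fin (n + 1)}
    (hne : cls b a ≠ cls b c) (hac : C.κ c = C.κ a + 1) :
    ∃ x', IsFlip b x x' a c ∧ ∀ i j, cls b i = cls b j → dif x' i j = dif x i j := by
  have hd := pos_of_cls_ne C hne
  set s : ℝ := dif x c a - fl x c a with hs
  have hs0 : 0 < s := sub_pos.2 (hx.fl_lt_dif hne.symm)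
  have hs1 : s < 1 := by have := lt_fl x c a; linarith
  -- Since `x_c - x_a` is an integer plus `s`, this shift exchanges the two fractional parts, up to
  -- integers and a common translation.
  let δ : Cls b → ℝ := fun D => if D = cls b a then s else if D = cls b c then -s else 0
  let x' : Fin n → ℝ := pt fun i => coord x i + δ (cls b i)
  have hx' : ∀ i j, dif x' i j = dif x i j + δ (cls b i) - δ (cls b j) := by
    intro i j; simp only [x', dif_pt]; simp only [dif]; ring
  have hcong : ∀ i j, cls b i = cls b j → dif x' i j = dif x i j := by
    intro i j h; rw [hx', h]; ring
  have hδa : δ (cls b a) = s := if_pos rfl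
  have hδc : δ (cls b c) = -s := by simp only [δ]; rw [if_neg hne.symm, if_true]
  have hδ : ∀ i, cls b i ≠ cls b a → cls b i ≠ cls b c → δ (cls b i) = 0 := by
    intro i h h'; simp only [δ]; rw [if_neg h, if_neg h']
  have red : ∀ {i i' j j'}, cls b i = cls b i' → cls b j = cls b j' →
      dif x' i j - fl x i j = dif x' i' j' - fl x i' j' := by
    intro i i' j j' hi hj
    have h1 := fl_add_fl_of_cls hx.1 hi j
    have h2 := fl_add_fl_of_cls_right hx.1 hj.symm i'
    have h3 := dif_eq_fl hx.1 hi
    have h4 := dif_eq_fl hx.1 hj.symm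
    have h5 : dif x i j = dif x i i' + dif x i' j' + dif x j' j := by
      rw [dif_add_dif, dif_add_dif]
    rw [hx', hx', hi, hj, h5, h3, h4, h1, h2]
    push_cast
    ring
  have hB : ∀ i, cls b i ≠ cls b a → cls b i ≠ cls b c →
      (fl x i a : ℝ) = fl x i c + fl x c a := by
    intro i h h'; exact_mod_cast C.fl_add_fl_of_succ hd hac h h'
  have hcm : ∀ i j, cls b i ≠ cls b j → (fl x i j : ℝ) = -fl x j i - 1 := by
    intro i j h; exact_mod_cast hx.fl_comm h
  refine ⟨x', ⟨hne, fun i j => ?_⟩, hcong⟩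
  have goal : ∀ e : ℤ, (e : ℝ) ≤ dif x' i j - fl x i j → dif x' i j - fl x i j < e + 1 →
      fl x' i j = fl x i j + e := by
    intro e h1 h2
    apply fl_eq <;> push_cast <;> linarith
  have goal' : ∀ e : ℤ, (e : ℝ) ≤ dif x' i j - fl x i j → dif x' i j - fl x i j < e + 1 →
      ((0 : ℤ) - (if cls b i = cls b c ∧ cls b j = cls b a then 1 else 0) +
        (if cls b i = cls b a ∧ cls b j = cls b c then 1 else 0) = e) →
      fl x' i j = fl x i j - (if cls b i = cls b c ∧ cls b j = cls b a then 1 else 0) +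
        (if cls b i = cls b a ∧ cls b j = cls b c then 1 else 0) := by
    intro e h1 h2 h3
    rw [goal e h1 h2, ← h3]; ring
  have ha' := dif_add_dif x c a j
  have hc' := dif_add_dif x i c a
  have hself : ∀ i, dif x' i i = 0 := dif_self x'
  have hflself : ∀ i, fl x i i = 0 := fun i => fl_of_dif_eq (by simp [dif_self])
  -- If exactly one of `i, j` is in the class of `a` or `c`, then `dif x' i j - fl x i j` is the
  -- fractional part of the difference at `x` with `a` and `c` exchanged, by `hB`; so the integral
  -- part stays.
  by_cases hia : cls b i = cls b a
  · have hic : cls b i ≠ cls b c := hia ▸ hne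
    by_cases hja : cls b j = cls b a
    · apply goal' 0
      · rw [red hia hja, hself, hflself]; simp
      · rw [red hia hja, hself, hflself]; simp
      · simp [hia, hja, hne]
    · by_cases hjc : cls b j = cls b c
      · have e : dif x' i j - fl x i j = 1 + s := by
          rw [red hia hjc, hx', hδa, hδc, hcm a c hne, dif_comm]; linarith
        apply goal' 1
        · rw [e]; push_cast; linarith
        · rw [e]; push_cast; linarith
        · simp [hia, hjc, hne]
      · have e : dif x' i j - fl x i j = dif x c j - fl x c j := by
          rw [red hia rfl, hx', hδa, hδ j hja hjc, hcm a j (Ne.symm hja),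
            hcm c j (Ne.symm hjc), hB j hja hjc]
          linarith
        apply goal' 0
        · rw [e]; push_cast; linarith [fl_le x c j]
        · rw [e]; push_cast; linarith [lt_fl x c j]
        · simp [hia, hja, hjc]
  · by_cases hic : cls b i = cls b c
    · by_cases hja : cls b j = cls b a
      · have e : dif x' i j - fl x i j = -s := by
          rw [red hic hja, hx', hδa, hδc]; linarith
        apply goal' (-1)
        · rw [e]; push_cast; linarith
        · rw [e]; push_cast; linarith
        · simp [hic, hja, hne]
      · by_cases hjc : cls b j = cls b c
        · apply goal' 0
          · rw [red hic hjc, hself, hflself]; simp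
          · rw [red hic hjc, hself, hflself]; simp
          · simp [hic, hjc, hne.symm]
        · have e : dif x' i j - fl x i j = dif x a j - fl x a j := by
            rw [red hic rfl, hx', hδc, hδ j hja hjc, hcm a j (Ne.symm hja),
              hcm c j (Ne.symm hjc), hB j hja hjc]
            linarith
          apply goal' 0
          · rw [e]; push_cast; linarith [fl_le x a j]
          · rw [e]; push_cast; linarith [lt_fl x a j]
          · simp [hic, hja, hjc]
    · by_cases hja : cls b j = cls b a
      · have e : dif x' i j - fl x i j = dif x i c - fl x i c := by
          rw [red rfl hja, hx', hδa, hδ i hia hic, hB i hia hic]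
          linarith
        apply goal' 0
        · rw [e]; push_cast; linarith [fl_le x i c]
        · rw [e]; push_cast; linarith [lt_fl x i c]
        · simp [hia, hic]
      · by_cases hjc : cls b j = cls b c
        · have e : dif x' i j - fl x i j = dif x i a - fl x i a := by
            rw [red rfl hjc, hx', hδc, hδ i hia hic, hB i hia hic]
            linarith
          apply goal' 0
          · rw [e]; push_cast; linarith [fl_le x i a]
          · rw [e]; push_cast; linarith [lt_fl x i a]
          · simp [hia, hic]
        · have e : dif x' i j - fl x i j = dif x i j - fl x i j := by
            rw [hx', hδ i hia hic, hδ j hja hjc]; ring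
          apply goal' 0
          · rw [e]; push_cast; linarith [fl_le x i j]
          · rw [e]; push_cast; linarith [lt_fl x i j]
          · simp [hia, hic]

/-- Crossing a facet that is visible from a regular point. -/
lemma exists_isFlip (hx : IsReg b x) {q : Fin n → ℝ} (hq : IsReg b q) (C : Chart b x d)
    {k : Fin (d + 1)} (hk : C.lam (coord q) 1 k < 0) :
    ∃ x', IsReg b x' ∧ IsFlip b x x' (C.σ k) (C.σ (k + 1)) := by
  have hd : 0 < d := by
    rcases Nat.eq_zero_or_pos d with hd | hd
    · rw [C.lam_zero_dim hd] at hk; linarith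
    · exact hd
  set a := C.σ k with ha
  set c := C.σ (k + 1) with hc
  have hac : C.κ c = C.κ a + 1 := by rw [ha, hc, C.κ_σ, C.κ_σ]
  have hne : cls b a ≠ cls b c := by
    rw [Ne, ← C.κ_eq, hac]
    rcases Chart.succ_cases hd (C.κ a) with h1 | h1
    · exact h1.1.ne
    · exact h1.2.2.ne'
  have hqx : fl q c a < fl x c a := by
    rw [C.lam_eq_dif hd, sub_neg] at hk
    exact fl_lt.2 hk
  obtain ⟨x', hflip, hcong⟩ := exists_fl_eq_of_succ hx C hne hac
  refine ⟨x', ⟨fun i j => ?_, fun i j l hl => ?_⟩, hflip⟩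
  · by_cases hij : cls b i = cls b j
    · rw [hcong i j hij]; exact hx.1 i j
    -- The flip raises the integral part only for the pair of classes `(a, c)`. There `fl q a c`
    -- exceeds `fl x a c`, so the bound satisfied by `q` leaves room.
    · suffices h : fl x' i j + 1 ≤ b i j by
        have h' : ((fl x' i j + 1 : ℤ) : ℝ) ≤ b i j := by exact_mod_cast h
        push_cast at h'
        linarith [lt_fl x' i j]
      have h1 := fl_lt.2 (hx.dif_lt hij)
      have h2 := fl_lt.2 (hq.dif_lt hij)
      rw [hflip.2]
      by_cases h3 : cls b i = cls b a ∧ cls b j = cls b c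
      · rw [if_pos h3]
        have h4 := fl_sub_fl_congr hq.1 hx.1 h3.1 h3.2
        rw [hq.fl_comm hne, hx.fl_comm hne] at h4
        split_ifs <;> omega
      · rw [if_neg h3]
        split_ifs <;> omega
  -- For an integral difference the integral parts for `(i, j)` and `(j, i)` sum to `0`; at `x` the
  -- sum is `-1`, and flips preserve it.
  · by_contra hij
    have h1 := fl_of_dif_eq hl
    have h2 : fl x' j i = -l := fl_of_dif_eq (by rw [dif_comm, hl]; simp)
    rw [hflip.2] at h1 h2
    have h3 := hx.fl_comm hij
    simp only [and_comm (a := cls b j = _)] at h2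
    omega

end Flips

/-! ### Common facets are flips -/

section Adjacency

variable {n : ℕ} {b : Fin (n + 1) → Fin (n + 1) → ℤ} {d : ℕ} {x x' : Fin n → ℝ}

lemma convex_alc (b : Fin (n + 1) → Fin (n + 1) → ℤ) : Convex ℝ (alc b) := by
  intro x hx y hy s t hs ht hst i j
  rw [dif_add, dif_smul, dif_smul]
  have h1 := mul_le_mul_of_nonneg_left (hx i j) hs
  have h2 := mul_le_mul_of_nonneg_left (hy i j) ht
  have h3 : s * (b i j : ℝ) + t * b i j = b i j := by rw [← add_mul, hst, one_mul]
  linarith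

lemma inter_closure_cell (x x' : Fin n → ℝ) : closure (cell x) ∩ closure (cell x') =
    alc (fun i j => min (-fl x j i) (-fl x' j i)) := by
  rw [closure_cell, closure_cell]
  ext y
  simp only [alc, Set.mem_inter_iff, Set.mem_ofPred_eq, Int.cast_min, le_min_iff, forall_and]

namespace IsFlip

variable {a c : Fin (n + 1)}

lemma dif_eq_of_mem_inter (hx : IsReg b x) (h : IsFlip b x x' a c) {y : Fin n → ℝ}
    (hy : y ∈ closure (cell x) ∩ closure (cell x')) : dif y c a = fl x c a := by
  have h1 := mem_closure_cell.1 hy.1 c a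
  have h2 := mem_closure_cell.1 hy.2 a c
  rw [h.fl_left, hx.fl_comm h.1, dif_comm] at h2
  push_cast at h2
  linarith

/-- Only the inequality between the classes of `a` and `c` becomes stronger for `x'`, and the
equation `hl` supplies it. -/
lemma mem_closure_cell_right (hx : IsReg b x) (h : IsFlip b x x' a c) {y : Fin n → ℝ}
    (hy : y ∈ closure (cell x)) (hl : dif y c a = fl x c a) : y ∈ closure (cell x') := by
  have hyb := closure_cell_subset_alc.2 hx.1 hy
  rw [mem_closure_cell] at hy ⊢
  intro i j
  have h1 := hy i j
  rw [h.2]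
  by_cases h2 : cls b i = cls b a ∧ cls b j = cls b c
  · have h3 : ¬(cls b i = cls b c ∧ cls b j = cls b a) := fun e => h.1 (h2.1.symm.trans e.1)
    rw [if_pos h2, if_neg h3]
    have e1 : fl x i j = fl x i a + fl x a c + fl x c j := by
      rw [fl_add_fl_of_cls hx.1 h2.1, fl_add_fl_of_cls_right hx.1 h2.2.symm a]; ring
    have e2 : dif y i j = dif y i a + dif y a c + dif y c j := by
      rw [dif_add_dif, dif_add_dif]
    rw [e1, e2, dif_eq_fl hyb h2.1, dif_eq_fl hyb h2.2.symm, fl_eq_of_cls_eq hx.1 hyb h2.1,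
      fl_eq_of_cls_eq hx.1 hyb h2.2.symm, hx.fl_comm h.1, dif_comm y a c, hl]
    push_cast
    linarith
  · rw [if_neg h2]
    split_ifs <;> push_cast <;> linarith

/-- A point in the relative interior of the common facet of two cells that differ by a flip. -/
lemma exists_mem_inter (hx : IsReg b x) (hx' : IsReg b x') (h : IsFlip b x x' a c) :
    ∃ y ∈ closure (cell x) ∩ closure (cell x'), ∀ i j, cls b i ≠ cls b j →
      ¬(cls b i = cls b c ∧ cls b j = cls b a) → ¬(cls b i = cls b a ∧ cls b j = cls b c) →
      (fl x i j : ℝ) < dif y i j := by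
  set s := dif x c a - fl x c a with hs
  set s' := fl x c a - dif x' c a with hs'
  have hs0 : 0 < s := sub_pos.2 (hx.fl_lt_dif h.1.symm)
  have hs0' : 0 < s' := by
    have := lt_fl x' c a
    rw [h.fl_right] at this
    push_cast at this
    linarith
  have hsum : s + s' ≠ 0 := by positivity
  -- The weights for which the segment from `x` to `x'` meets the hyperplane `x_c - x_a = fl x c a`.
  set α := s' / (s + s') with hα
  set β := s / (s + s') with hβ
  have hα0 : 0 < α := by positivity
  have hβ0 : 0 < β := by positivity
  have hαβ : α + β = 1 := by rw [hα, hβ]; field_simp; ring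
  have hcomb : ∀ r : ℝ, r = α * r + β * r := fun r => by rw [← add_mul, hαβ, one_mul]
  set y := α • x + β • x' with hy
  have hdif : ∀ i j, dif y i j = α * dif x i j + β * dif x' i j := fun i j => by
    rw [hy, dif_add, dif_smul, dif_smul]
  have hyb : y ∈ alc b := convex_alc b hx.1 hx'.1 hα0.le hβ0.le hαβ
  have hyl : dif y c a = fl x c a := by
    have e1 : dif x c a = fl x c a + s := by rw [hs]; ring
    have e2 : dif x' c a = fl x c a - s' := by rw [hs']; ring
    rw [hdif, e1, e2, hα, hβ]
    field_simp
    ring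
  have hmem : y ∈ closure (cell x) := by
    rw [mem_closure_cell]
    intro i j
    by_cases h1 : cls b i = cls b c ∧ cls b j = cls b a
    · have e1 : fl x i j = fl x i c + fl x c a + fl x a j := by
        rw [fl_add_fl_of_cls hx.1 h1.1, fl_add_fl_of_cls_right hx.1 h1.2.symm c]; ring
      have e2 : dif y i j = dif y i c + dif y c a + dif y a j := by
        rw [dif_add_dif, dif_add_dif]
      rw [e1, e2, dif_eq_fl hyb h1.1, dif_eq_fl hyb h1.2.symm, fl_eq_of_cls_eq hx.1 hyb h1.1,
        fl_eq_of_cls_eq hx.1 hyb h1.2.symm, hyl]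
      push_cast
      exact le_rfl
    · have h2 : fl x i j ≤ fl x' i j := by
        rw [h.2, if_neg h1]; split_ifs <;> omega
      have h3 : (fl x i j : ℝ) ≤ fl x' i j := by exact_mod_cast h2
      have h4 := fl_le x i j
      have h5 := fl_le x' i j
      rw [hdif, hcomb (fl x i j)]
      exact add_le_add (mul_le_mul_of_nonneg_left h4 hα0.le)
        (mul_le_mul_of_nonneg_left (h3.trans h5) hβ0.le)
  refine ⟨y, ⟨hmem, h.mem_closure_cell_right hx hmem hyl⟩, fun i j hij h1 h2 => ?_⟩
  have h3 : fl x' i j = fl x i j := by rw [h.2, if_neg h1, if_neg h2]; ring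
  have h4 := hx.fl_lt_dif hij
  have h5 := hx'.fl_lt_dif hij
  rw [h3] at h5
  rw [hdif, hcomb (fl x i j)]
  exact add_lt_add (mul_lt_mul_of_pos_left h4 hα0) (mul_lt_mul_of_pos_left h5 hβ0)

/-- The functional `-(x_c - x_a)` exposes the intersection, and merging the classes of `a` and `c`
lowers the dimension by exactly one. -/
lemma isFacet (hx : IsReg b x) (hx' : IsReg b x') (h : IsFlip b x x' a c) :
    IsFacet (closure (cell x) ∩ closure (cell x')) (closure (cell x)) := by
  obtain ⟨y, hy, hlt⟩ := h.exists_mem_inter hx hx'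
  have hyl := h.dif_eq_of_mem_inter hx hy
  have hsub := closure_cell_subset_alc.2 hx.1
  constructor
  · intro _
    refine ⟨-(LinearMap.toContinuousLinearMap (difLin c a)), ?_⟩
    ext z
    change z ∈ closure (cell x) ∩ closure (cell x') ↔
      z ∈ closure (cell x) ∧ ∀ w ∈ closure (cell x), -dif w c a ≤ -dif z c a
    constructor
    · intro hz
      refine ⟨hz.1, fun w hw => ?_⟩
      rw [h.dif_eq_of_mem_inter hx hz]
      exact neg_le_neg (mem_closure_cell.1 hw c a)
    · rintro ⟨hz, hmin⟩
      refine ⟨hz, h.mem_closure_cell_right hx hz (le_antisymm ?_ (mem_closure_cell.1 hz c a))⟩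
      rw [← hyl]
      exact neg_le_neg_iff.1 (hmin y hy.1)
  · have h1 : polyDim (closure (cell x) ∩ closure (cell x')) + 1 =
        Fintype.card {C : Cls b // C ≠ cls b c} := by
      have hconst : ∀ i j, mergeMap (cls b a) (cls b c) h.1 (cls b i) =
          mergeMap (cls b a) (cls b c) h.1 (cls b j) →
          constDif (closure (cell x) ∩ closure (cell x')) i j := by
        intro i j hij
        refine constDif_of_mergeMap (fun i j e z hz w hw => ?_) h.1 (fun z hz w hw => ?_) hij
        · exact cls_eq.1 e z (hsub hz.1) w (hsub hw.1)
        · rw [dif_comm, dif_comm w, h.dif_eq_of_mem_inter hx hz, h.dif_eq_of_mem_inter hx hw]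
      rw [inter_closure_cell] at hy hconst ⊢
      refine polyDim_alc (h := mergeMap (cls b a) (cls b c) h.1 ∘ cls b)
        ((mergeMap_surjective h.1).comp cls_surjective) hconst hy fun i j hij => ?_
      have hij' := mt (mergeMap_eq_iff h.1).2 hij
      push Not at hij'
      have e1 : ¬(cls b j = cls b c ∧ cls b i = cls b a) := fun e => hij'.2.1 e.2 e.1
      have e2 : ¬(cls b j = cls b a ∧ cls b i = cls b c) := fun e => hij'.2.2 e.2 e.1
      have h2 := hlt j i hij'.1.symm e1 e2
      have h3 : fl x' j i = fl x j i := by rw [h.2, if_neg e1, if_neg e2]; ring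
      rw [h3, min_self, dif_comm]
      push_cast
      linarith
    have h2 := hx.polyDim_closure_cell
    have h3 := card_ne (cls b c)
    omega

end IsFlip

/-- Cells that meet in a facet differ by a flip. -/
lemma exists_isFlip_of_isFacet (hx : IsReg b x) (hx' : IsReg b x')
    (hne : closure (cell x) ≠ closure (cell x'))
    (hF : IsFacet (closure (cell x) ∩ closure (cell x')) (closure (cell x))) :
    ∃ a c, IsFlip b x x' a c := by
  obtain ⟨a, c, hca⟩ : ∃ a c, fl x' c a < fl x c a := by
    by_contra! hcon
    refine hne (congrArg closure (cell_eq_of_fl_eq fun i j => ?_))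
    refine le_antisymm (hcon j i) ?_
    by_cases hij : cls b i = cls b j
    · exact (fl_eq_of_cls_eq hx'.1 hx.1 hij).le
    · have h1 := hcon i j
      rw [hx.fl_comm (Ne.symm hij), hx'.fl_comm (Ne.symm hij)] at h1
      omega
  have hcls : ∀ {i j}, fl x i j ≠ fl x' i j → cls b i ≠ cls b j :=
    fun h e => h (fl_eq_of_cls_eq hx.1 hx'.1 e)
  have hac : cls b a ≠ cls b c := (hcls hca.ne').symm
  set S := closure (cell x) ∩ closure (cell x') with hS
  have hdim : polyDim S + 2 = Fintype.card (Cls b) := by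
    have := hx.polyDim_closure_cell
    have := hF.2
    omega
  have hcard : 1 < Fintype.card (Cls b) := Fintype.one_lt_card_iff.2 ⟨_, _, hac⟩
  obtain ⟨y, hy⟩ : S.Nonempty := by
    by_contra hemp
    simp only [polyDim, if_neg hemp] at hdim
    omega
  -- On the intersection, such a difference is at least `fl x i j` and at most `fl x' i j + 1`. So
  -- it is constant, and the drop is exactly one.
  have key : ∀ {i j}, fl x' i j < fl x i j → ∀ z ∈ S,
      dif z i j = fl x i j ∧ fl x' i j = fl x i j - 1 := by
    intro i j hij z hz
    have h1 := mem_closure_cell.1 hz.1 i j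
    have h2 := mem_closure_cell.1 hz.2 j i
    rw [hx'.fl_comm (hcls hij.ne').symm, dif_comm] at h2
    have h3 : (fl x' i j : ℝ) + 1 ≤ fl x i j := by exact_mod_cast hij
    push_cast at h2
    refine ⟨by linarith, ?_⟩
    have h4 : (fl x i j : ℝ) ≤ fl x' i j + 1 := by linarith
    have h5 : fl x i j ≤ fl x' i j + 1 := by exact_mod_cast h4
    omega
  have hconst : ∀ {i j}, fl x i j ≠ fl x' i j → constDif S i j := by
    intro i j hij
    rcases lt_or_gt_of_ne hij with h1 | h1
    · have h2 : fl x' j i < fl x j i := by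
        rw [hx.fl_comm (hcls hij).symm, hx'.fl_comm (hcls hij).symm]; omega
      intro z hz w hw
      rw [dif_comm, dif_comm w, (key h2 z hz).1, (key h2 w hw).1]
    · intro z hz w hw
      rw [(key h1 z hz).1, (key h1 w hw).1]
  refine ⟨a, c, hac, fun i j => ?_⟩
  have h1 := (key hca y hy).2
  by_cases hi : cls b i = cls b c ∧ cls b j = cls b a
  · have hi' : ¬(cls b i = cls b a ∧ cls b j = cls b c) := fun e => hac (e.1.symm.trans hi.1)
    rw [if_pos hi, if_neg hi']
    have := fl_sub_fl_congr hx.1 hx'.1 hi.1 hi.2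
    omega
  · by_cases hi' : cls b i = cls b a ∧ cls b j = cls b c
    · rw [if_neg hi, if_pos hi']
      have h2 := fl_sub_fl_congr hx.1 hx'.1 hi'.1 hi'.2
      rw [hx.fl_comm hac, hx'.fl_comm hac] at h2
      omega
    · rw [if_neg hi, if_neg hi']
      -- A further separated pair would be a second independent constant difference on `S`, and the
      -- dimension would drop by two.
      by_contra hij
      have hij : fl x i j ≠ fl x' i j := fun e => hij (by omega)
      have hsub := closure_cell_subset_alc.2 hx.1
      have hS' : ∀ i j, cls b i = cls b j → constDif S i j := fun i j e z hz w hw =>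
        cls_eq.1 e z (hsub hz.1) w (hsub hw.1)
      have h2 := polyDim_add_two_le (h := mergeMap (cls b a) (cls b c) hac ∘ cls b) (S := S)
        ((mergeMap_surjective hac).comp cls_surjective)
        (fun i j e => constDif_of_mergeMap hS' hac
          ((constDif S).symm (hconst hca.ne')) e) (a := i) (c := j) (fun e => ?_) (hconst hij)
      · have h3 := card_ne (cls b c)
        omega
      · rcases (mergeMap_eq_iff hac).1 e with e | e | e
        · exact hcls hij e
        · exact hi' e
        · exact hi e

end Adjacency

/-! ### Graph distance from a potential -/

section Distance

/-- Along any walk `ρ` grows by at most two per edge, and descending by two per edge reaches `v₀`.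
-/
lemma two_mul_dist {V : Type*} {G : SimpleGraph V} {v₀ : V} {ρ : V → ℕ} (h0 : ρ v₀ = 0)
    (hadj : ∀ u v, G.Adj u v → ρ v ≤ ρ u + 2)
    (hstep : ∀ u, u ≠ v₀ → ∃ w, G.Adj w u ∧ ρ w + 2 = ρ u) (u : V) :
    2 * G.dist v₀ u = ρ u := by
  have hub : ∀ m u, ρ u = m → ∃ w : G.Walk v₀ u, 2 * w.length ≤ ρ u := by
    intro m
    induction m using Nat.strong_induction_on with
    | _ m ih =>
      intro u hu
      by_cases huv : u = v₀
      · subst huv; exact ⟨SimpleGraph.Walk.nil, by simp⟩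
      · obtain ⟨w, hw, hρ⟩ := hstep u huv
        obtain ⟨p, hp⟩ := ih (ρ w) (by omega) w rfl
        exact ⟨p.concat hw, by rw [SimpleGraph.Walk.length_concat]; omega⟩
  have hlb : ∀ {a u} (p : G.Walk a u), ρ u ≤ ρ a + 2 * p.length := by
    intro a u p
    induction p with
    | nil => simp
    | cons h p ih =>
      have := hadj _ _ h
      rw [SimpleGraph.Walk.length_cons]
      omega
  obtain ⟨p, hp⟩ := hub _ u rfl
  obtain ⟨p', hp'⟩ := p.reachable.exists_walk_length_eq_dist
  have h1 := hlb p'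
  have h2 := G.dist_le p
  omega

end Distance

/-! ### Incoming arcs and visible facets -/

section Arcs

variable {n : ℕ} {b : Fin (n + 1) → Fin (n + 1) → ℤ} {d : ℕ}

/-- A regular point in the interior of a simplex of the alcoved triangulation. -/
noncomputable def pnt (F : alcovedTriangulation (alc b)) : Fin n → ℝ :=
  (exists_isReg F.2).choose

lemma isReg_pnt (F : alcovedTriangulation (alc b)) : IsReg b (pnt F) :=
  (exists_isReg F.2).choose_spec.1

lemma closure_cell_pnt (F : alcovedTriangulation (alc b)) : closure (cell (pnt F)) = F :=
  (exists_isReg F.2).choose_spec.2.symm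

lemma ext_fl_pnt {F F' : alcovedTriangulation (alc b)}
    (h : ∀ i j, fl (pnt F) i j = fl (pnt F') i j) : F = F' :=
  Subtype.ext (by rw [← closure_cell_pnt, ← closure_cell_pnt, cell_eq_of_fl_eq h])

/-- The simplex of the alcoved triangulation that contains a given regular point. -/
lemma exists_pnt_fl_eq {x : Fin n → ℝ} (hx : IsReg b x) :
    ∃ F : alcovedTriangulation (alc b), ∀ i j, fl (pnt F) i j = fl x i j := by
  let F : alcovedTriangulation (alc b) :=
    ⟨closure (cell x), (mem_alcovedTriangulation_iff hx).2 ⟨x, hx, rfl⟩⟩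
  exact ⟨F, fl_eq_of_closure_cell_eq (closure_cell_pnt F)⟩

/-- A simplex is determined by the integral parts at its chosen point, which are integers between
`-b j i` and `b i j`. -/
lemma finite_alcovedTriangulation (b : Fin (n + 1) → Fin (n + 1) → ℤ) :
    (alcovedTriangulation (alc b)).Finite := by
  rw [← Set.finite_coe_iff]
  have hfin : (Set.Icc (fun i j => -b j i) b).Finite := Set.finite_Icc _ _
  have := hfin.to_subtype
  refine Finite.of_injective (β := Set.Icc (fun i j => -b j i) b)
    (fun F => ⟨fun i j => fl (pnt F) i j, fun i j => ?_, fun i j => ?_⟩) fun F F' h => ?_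
  · rw [le_fl, dif_comm]
    have := (isReg_pnt F).1 j i
    push_cast
    linarith
  · have h1 := (isReg_pnt F).1 i j
    have h2 := fl_le (pnt F) i j
    exact_mod_cast h2.trans h1
  · exact ext_fl_pnt fun i j => congrFun (congrFun (Subtype.ext_iff.1 h) i) j

lemma dualGraph_adj_iff {F F' : alcovedTriangulation (alc b)} :
    (dualGraph (alcovedTriangulation (alc b))).Adj F F' ↔
      ∃ a c, IsFlip b (pnt F) (pnt F') a c := by
  constructor
  · rintro ⟨hne, h1, -⟩
    rw [← closure_cell_pnt F, ← closure_cell_pnt F'] at h1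
    refine exists_isFlip_of_isFacet (isReg_pnt F) (isReg_pnt F') (fun e => hne ?_) h1
    rw [closure_cell_pnt, closure_cell_pnt] at e
    exact Subtype.ext e
  · rintro ⟨a, c, h⟩
    refine ⟨fun e => ?_, ?_, ?_⟩
    · have := h.fl_right
      rw [e] at this
      omega
    · rw [← closure_cell_pnt F, ← closure_cell_pnt F']
      exact h.isFacet (isReg_pnt F) (isReg_pnt F')
    · rw [Set.inter_comm, ← closure_cell_pnt F, ← closure_cell_pnt F']
      exact h.symm.isFacet (isReg_pnt F') (isReg_pnt F)

lemma exists_adj_isFlip {F₀ F : alcovedTriangulation (alc b)} (C : Chart b (pnt F) d)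
    {k : Fin (d + 1)} (hk : C.lam (coord (pnt F₀)) 1 k < 0) :
    ∃ F' : alcovedTriangulation (alc b), IsFlip b (pnt F) (pnt F') (C.σ k) (C.σ (k + 1)) := by
  obtain ⟨x', hx', h⟩ := exists_isFlip (isReg_pnt F) (isReg_pnt F₀) C hk
  obtain ⟨F', hF'⟩ := exists_pnt_fl_eq hx'
  exact ⟨F', h.1, fun i j => by rw [hF', h.2]⟩

lemma fl_lt_of_lam_neg {x q : Fin n → ℝ} (C : Chart b x d) {k : Fin (d + 1)}
    (hk : C.lam (coord q) 1 k < 0) :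
    fl q (C.σ (k + 1)) (C.σ k) < fl x (C.σ (k + 1)) (C.σ k) := by
  rcases Nat.eq_zero_or_pos d with hd | hd
  · rw [C.lam_zero_dim hd] at hk; linarith
  · rw [C.lam_eq_dif hd, sub_neg] at hk
    exact fl_lt.2 hk

lemma two_mul_dist_dualGraph (hd : Fintype.card (Cls b) = d + 1)
    (F₀ F : alcovedTriangulation (alc b)) :
    2 * (dualGraph (alcovedTriangulation (alc b))).dist F₀ F = sep b (pnt F₀) (pnt F) := by
  refine two_mul_dist (ρ := fun F => sep b (pnt F₀) (pnt F)) (sep_self _) (fun F F' h => ?_)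
    (fun F hF => ?_) F
  · obtain ⟨a, c, h⟩ := dualGraph_adj_iff.1 h
    rcases lt_or_ge (fl (pnt F₀) c a) (fl (pnt F) c a) with h1 | h1
    · have := h.sep_add_two (isReg_pnt F₀) (isReg_pnt F) h1
      omega
    · exact (h.sep_eq_add_two (isReg_pnt F₀) (isReg_pnt F) (isReg_pnt F') h1).le
  · obtain ⟨C⟩ := (isReg_pnt F).nonempty_chart hd
    -- With no visible facet, all facet inequalities of `F` hold strictly at the point of `F₀`,
    -- which would then lie in the open cell of `F`.
    have : ∃ k, C.lam (coord (pnt F₀)) 1 k < 0 := by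
      by_contra! hcon
      refine hF (ext_fl_pnt fun i j => ?_)
      refine (mem_cell_iff.1 ((C.mem_cell_iff (isReg_pnt F)).2 ⟨fun i j hij => ?_, fun k => ?_⟩)
        i j).symm
      · exact cls_eq.1 hij _ (isReg_pnt F₀).1 _ (isReg_pnt F).1
      · refine lt_of_le_of_ne (hcon k) ?_
        rcases Nat.eq_zero_or_pos d with h0 | h0
        · rw [C.lam_zero_dim h0]; exact zero_ne_one
        · exact (C.lam_ne_zero h0 (isReg_pnt F₀) k).symm
    obtain ⟨k, hk⟩ := this
    obtain ⟨F', hF'⟩ := exists_adj_isFlip C hk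
    exact ⟨F', dualGraph_adj_iff.2 ⟨_, _, hF'.symm⟩,
      hF'.sep_add_two (isReg_pnt F₀) (isReg_pnt F) (fl_lt_of_lam_neg C hk)⟩

/-- The positions of the facets of a cell that are visible from `q`. -/
noncomputable def visible {x : Fin n → ℝ} (C : Chart b x d) (q : Fin n → ℝ) :
    Finset (Fin (d + 1)) :=
  open scoped Classical in Finset.univ.filter fun k => C.lam (coord q) 1 k < 0

lemma mem_visible {x q : Fin n → ℝ} {C : Chart b x d} {k : Fin (d + 1)} :
    k ∈ visible C q ↔ C.lam (coord q) 1 k < 0 := by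
  simp [visible]

/-- Incoming arcs correspond to visible facets. -/
lemma encard_incoming (hd : Fintype.card (Cls b) = d + 1)
    (F₀ F : alcovedTriangulation (alc b)) (C : Chart b (pnt F) d) :
    {F' | (orientAway (dualGraph (alcovedTriangulation (alc b))) F₀).Adj F' F}.encard =
      (visible C (pnt F₀)).card := by
  have hex : ∀ k : {k // k ∈ visible C (pnt F₀)}, ∃ F' : alcovedTriangulation (alc b),
      IsFlip b (pnt F) (pnt F') (C.σ k) (C.σ (k + 1)) := fun k =>
    exists_adj_isFlip C (mem_visible.1 k.2)
  choose f hf using hex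
  have hinj : Function.Injective f := by
    intro k k' hkk
    have h1 := hf k
    have h2 := (hf k').fl_right
    rw [← hkk, h1.2] at h2
    have h3 : cls b (C.σ (k' + 1)) = cls b (C.σ (k + 1)) ∧ cls b (C.σ k') = cls b (C.σ k) := by
      by_contra hcon
      rw [if_neg hcon] at h2
      split_ifs at h2 <;> omega
    have h4 := C.κ_eq.2 h3.2
    rw [C.κ_σ, C.κ_σ] at h4
    exact Subtype.ext h4.symm
  have hrange : {F' | (orientAway (dualGraph (alcovedTriangulation (alc b))) F₀).Adj F' F} =
      Set.range f := by
    ext F'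
    change (dualGraph (alcovedTriangulation (alc b))).Adj F' F ∧
      (dualGraph (alcovedTriangulation (alc b))).dist F₀ F =
        (dualGraph (alcovedTriangulation (alc b))).dist F₀ F' + 1 ↔ _
    have hdF := two_mul_dist_dualGraph hd F₀ F
    have hdF' := two_mul_dist_dualGraph hd F₀ F'
    constructor
    · rintro ⟨hadj, hdist⟩
      obtain ⟨a, c, h⟩ := dualGraph_adj_iff.1 hadj.symm
      have hlt : fl (pnt F₀) c a < fl (pnt F) c a := by
        by_contra! hge
        have := h.sep_eq_add_two (isReg_pnt F₀) (isReg_pnt F) (isReg_pnt F') hge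
        omega
      -- The classes of `a` and `c` are neighbours, so the common facet is the one at position `C.κ
      -- a`.
      have hκ := h.κ_eq C
      have ha : cls b (C.σ (C.κ a)) = cls b a := C.cls_σ a
      have hc : cls b (C.σ (C.κ a + 1)) = cls b c := by rw [← hκ]; exact C.cls_σ c
      have hk : C.κ a ∈ visible C (pnt F₀) := by
        rw [mem_visible, C.lam_eq_dif (pos_of_cls_ne C h.1), sub_neg, ← fl_lt]
        have := fl_sub_fl_congr (isReg_pnt F₀).1 (isReg_pnt F).1 hc ha
        omega
      refine ⟨⟨_, hk⟩, ext_fl_pnt fun i j => ?_⟩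
      rw [(hf ⟨_, hk⟩).2, (h.congr ha hc).2]
    · rintro ⟨k, rfl⟩
      refine ⟨(dualGraph_adj_iff.2 ⟨_, _, hf k⟩).symm, ?_⟩
      have := (hf k).sep_add_two (isReg_pnt F₀) (isReg_pnt F)
        (fl_lt_of_lam_neg C (mem_visible.1 k.2))
      omega
  rw [hrange, ← Set.image_univ, hinj.encard_image, Set.encard_univ]
  simp

end Arcs

/-! ### Series of a half-open unimodular simplex -/

section Weights

variable {m : ℕ}

/-- The exponent vectors of total degree `t` that are positive at all positions in `S`. -/
noncomputable def weights (S : Finset (Fin m)) (t : ℕ) : Finset (Fin m →₀ ℕ) :=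
  (Finset.univ.finsuppAntidiag t).filter fun l => ∀ k ∈ S, 1 ≤ l k

lemma mem_weights {S : Finset (Fin m)} {t : ℕ} {l : Fin m →₀ ℕ} :
    l ∈ weights S t ↔ ∑ k, l k = t ∧ ∀ k ∈ S, 1 ≤ l k := by
  simp [weights, Finset.mem_finsuppAntidiag]

/-- The generating function of the lattice points in dilations of a half-open unimodular simplex. -/
lemma one_sub_X_pow_mul_weights (S : Finset (Fin m)) :
    ((1 - PowerSeries.X) ^ m * PowerSeries.mk fun t => ((weights S t).card : ℤ)) =
      (PowerSeries.X ^ S.card : PowerSeries ℤ) := by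
  let G : PowerSeries ℤ := PowerSeries.mk 1
  have hG : G * (1 - PowerSeries.X) = 1 := PowerSeries.mk_one_mul_one_sub_eq_one ℤ
  -- One factor per barycentric coordinate: `z / (1 - z)` if it must be positive, `1 / (1 - z)`
  -- otherwise.
  let g : Fin m → PowerSeries ℤ := fun k => if k ∈ S then PowerSeries.X * G else G
  have hcoeff : ∀ k j, PowerSeries.coeff j (g k) = if k ∈ S → 1 ≤ j then 1 else 0 := by
    intro k j
    simp only [g]
    by_cases hk : k ∈ S
    · rw [if_pos hk]
      cases j with
      | zero => simp [hk]
      | succ j => simp [hk, PowerSeries.coeff_succ_X_mul, G]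
    · simp [hk, G]
  have hprod : (PowerSeries.mk fun t => ((weights S t).card : ℤ)) = ∏ k, g k := by
    ext t
    rw [PowerSeries.coeff_mk, PowerSeries.coeff_prod]
    simp only [hcoeff, Finset.prod_boole]
    rw [weights, Finset.card_filter]
    push_cast
    simp
  have hpow : (1 - PowerSeries.X : PowerSeries ℤ) ^ m = ∏ _k : Fin m, (1 - PowerSeries.X) := by
    simp
  have hone : ∀ k, (1 - PowerSeries.X) * g k = if k ∈ S then PowerSeries.X else 1 := by
    intro k
    simp only [g]
    split_ifs
    · rw [mul_comm, mul_assoc, hG, mul_one]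
    · rw [mul_comm, hG]
  rw [hprod, hpow, ← Finset.prod_mul_distrib, Finset.prod_congr rfl fun k _ => hone k,
    Finset.prod_ite_mem]
  simp

end Weights

/-! ### Lattice points and the half-open decomposition -/

section Counting

variable {n : ℕ} {b : Fin (n + 1) → Fin (n + 1) → ℤ} {d : ℕ} {x : Fin n → ℝ}

namespace Chart

variable (C : Chart b x d)

lemma lam_smul (Y : Fin (n + 1) → ℝ) (t a : ℝ) (k : Fin (d + 1)) :
    C.lam (fun i => a * Y i) (a * t) k = a * C.lam Y t k := by
  simp only [lam]
  split_ifs <;> ring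

/-- The differences cancel around the cycle of positions; the extra `t` at the last one remains. -/
lemma sum_lam (Y : Fin (n + 1) → ℝ) (t : ℝ) : ∑ k, C.lam Y t k = t := by
  have h : ∀ f : Fin (d + 1) → ℝ, ∑ k, f (k + 1) = ∑ k, f k := fun f =>
    Equiv.sum_comp (Equiv.addRight 1) f
  simp only [lam]
  rw [Finset.sum_add_distrib, Finset.sum_sub_distrib, Finset.sum_sub_distrib, ← Finset.mul_sum,
    Finset.sum_sub_distrib, h fun k => Y (C.σ k), h fun k => (⌊coord x (C.σ k)⌋ : ℝ)]
  simp

/-- The homogenized barycentric coordinates determine a point. -/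
lemma eq_of_lam_eq {y z : Fin n → ℝ} {t : ℝ}
    (h : ∀ i j, cls b i = cls b j → dif y i j = dif z i j)
    (hl : ∀ k, C.lam (coord y) t k = C.lam (coord z) t k) : y = z := by
  let w : Fin (d + 1) → ℝ := fun k => coord y (C.σ k) - coord z (C.σ k)
  have hstep : ∀ k, w (k + 1) = w k := by
    intro k
    have := hl k
    simp only [lam] at this
    simp only [w]
    linarith
  have hconst : ∀ k, w k = w 0 := by
    intro k
    induction k using Fin.induction with
    | zero => rfl
    | succ k ih => rw [← Fin.coeSucc_eq_succ, hstep, ih]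
  have hw : ∀ i, coord y i - coord z i = w (C.κ i) := by
    intro i
    have := h _ _ (C.cls_σ i)
    simp only [dif] at this
    simp only [w]
    linarith
  refine ext_dif fun i j => ?_
  have h1 := hw i
  have h2 := hw j
  rw [hconst] at h1 h2
  simp only [dif]
  linarith

/-- The lattice point with given homogenized barycentric coordinates. -/
noncomputable def latticePoint (t : ℕ) (l : Fin (d + 1) →₀ ℕ) : Fin n → ℤ := fun i =>
  t * ⌊coord x i.succ⌋ + ∑ j ∈ Finset.Iio (C.κ i.succ), (l j : ℤ)

lemma coord_latticePoint (t : ℕ) (l : Fin (d + 1) →₀ ℕ) (i : Fin (n + 1)) :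
    coord (fun i => (C.latticePoint t l i : ℝ)) i =
      t * ⌊coord x i⌋ + ∑ j ∈ Finset.Iio (C.κ i), (l j : ℝ) := by
  refine Fin.cases ?_ (fun i => ?_) i
  · have : Finset.Iio (0 : Fin (d + 1)) = ∅ := by ext j; simp
    rw [C.κ_zero, this]
    simp
  · rw [coord_succ, latticePoint]
    push_cast
    rfl

lemma dif_latticePoint (hx : x ∈ alc b) (t : ℕ) (l : Fin (d + 1) →₀ ℕ) {i j : Fin (n + 1)}
    (h : cls b i = cls b j) :
    dif (fun i => (C.latticePoint t l i : ℝ)) i j = t * dif x i j := by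
  rw [dif, coord_latticePoint, coord_latticePoint, C.κ_eq.2 h, ← floor_sub_of_cls hx h]
  ring

lemma lam_latticePoint {t : ℕ} {l : Fin (d + 1) →₀ ℕ} (hl : ∑ k, l k = t) (k : Fin (d + 1)) :
    C.lam (coord fun i => (C.latticePoint t l i : ℝ)) t k = l k := by
  rw [lam, coord_latticePoint, coord_latticePoint, C.κ_σ, C.κ_σ]
  refine Fin.lastCases ?_ (fun k => ?_) k
  -- At the last position the value is `t` minus all other weights; here the total degree `hl` is
  -- used.
  · have h0 : Finset.Iio (0 : Fin (d + 1)) = ∅ := by ext j; simp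
    have h1 : Finset.univ = insert (Fin.last d) (Finset.Iio (Fin.last d)) := by
      ext j
      rw [Finset.mem_insert, Finset.mem_Iio]
      exact ⟨fun _ => eq_or_lt_of_le (Fin.le_last j), fun _ => Finset.mem_univ j⟩
    have h2 : (t : ℝ) = l (Fin.last d) + ∑ j ∈ Finset.Iio (Fin.last d), (l j : ℝ) := by
      rw [← hl, h1, Finset.sum_insert (by simp)]
      push_cast
      rfl
    rw [if_pos rfl, Fin.last_add_one, h0, Finset.sum_empty]
    linarith
  · have h1 : Finset.Iio k.succ = insert k.castSucc (Finset.Iio k.castSucc) := by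
      ext j
      rw [Finset.mem_Iio, Finset.mem_insert, Finset.mem_Iio, ← le_iff_eq_or_lt,
        Fin.le_castSucc_iff]
    rw [Fin.coeSucc_eq_succ, if_neg (Fin.castSucc_lt_last k).ne, h1,
      Finset.sum_insert (by simp)]
    ring

end Chart

lemma mem_smul_alc (hne : (alc b).Nonempty) (t : ℕ) (y : Fin n → ℝ) :
    y ∈ (t : ℝ) • alc b ↔ ∀ i j, dif y i j ≤ t * b i j := by
  rcases Nat.eq_zero_or_pos t with rfl | ht
  · rw [Nat.cast_zero, Set.zero_smul_set hne, Set.mem_zero]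
    constructor
    · rintro rfl i j
      have := dif_smul 0 (0 : Fin n → ℝ) i j
      simp at this
      simp [this]
    · intro h
      funext i
      have h1 := h i.succ 0
      have h2 := h 0 i.succ
      rw [dif_comm, dif_zero] at h2
      rw [dif_zero] at h1
      simp only [zero_mul] at h1 h2
      simp only [Pi.zero_apply]
      linarith
  · have ht' : (0 : ℝ) < t := by exact_mod_cast ht
    rw [Set.mem_smul_set_iff_inv_smul_mem₀ ht'.ne']
    simp only [alc, Set.mem_ofPred_eq, dif_smul, inv_mul_le_iff₀ ht']

/-- All differences, integral parts and bounds have absolute value at most `B`. So one `ε`,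
independent of `t`, keeps each perturbation of an integer in this argument below one. -/
lemma exists_small (b : Fin (n + 1) → Fin (n + 1) → ℤ) : ∃ ε : ℝ, 0 < ε ∧ ε < 1 ∧
    ∀ q ∈ alc b, (∀ x ∈ alc b, ∀ i j, ε * |dif q i j - fl x i j| < 1) ∧
      ∀ i j, ε * |dif q i j - b i j| < 1 := by
  set B : ℝ := ∑ i, ∑ j, |(b i j : ℝ)| with hB
  have hbB : ∀ i j, |(b i j : ℝ)| ≤ B := by
    intro i j
    refine le_trans ?_ (Finset.single_le_sum (f := fun i => ∑ j, |(b i j : ℝ)|)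
      (fun i _ => Finset.sum_nonneg fun j _ => abs_nonneg _) (Finset.mem_univ i))
    exact Finset.single_le_sum (f := fun j => |(b i j : ℝ)|)
      (fun j _ => abs_nonneg _) (Finset.mem_univ j)
  have hB0 : 0 ≤ B := (abs_nonneg _).trans (hbB 0 0)
  have hq : ∀ q ∈ alc b, ∀ i j, |dif q i j| ≤ B := by
    intro q hq i j
    have h1 := hq i j
    have h2 := hq j i
    rw [dif_comm] at h2
    rw [abs_le]
    constructor
    · linarith [le_abs_self (b j i : ℝ), hbB j i]
    · linarith [le_abs_self (b i j : ℝ), hbB i j]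
  have hfl : ∀ x ∈ alc b, ∀ i j, |(fl x i j : ℝ)| ≤ B := by
    intro x hx i j
    have h1 := (fl_le x i j).trans (hx i j)
    have h2 : -b j i ≤ fl x i j := by
      rw [le_fl, dif_comm]; push_cast; linarith [hx j i]
    have h3 : ((-b j i : ℤ) : ℝ) ≤ fl x i j := by exact_mod_cast h2
    push_cast at h3
    rw [abs_le]
    constructor
    · linarith [le_abs_self (b j i : ℝ), hbB j i]
    · linarith [le_abs_self (b i j : ℝ), hbB i j]
  have key : ∀ r s : ℝ, |r| ≤ B → |s| ≤ B → 1 / (2 * B + 2) * |r - s| < 1 := by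
    intro r s hr hs
    have := abs_sub r s
    rw [one_div, inv_mul_lt_iff₀ (by positivity)]
    linarith
  refine ⟨1 / (2 * B + 2), by positivity, ?_, fun q hq' => ⟨fun x hx i j => ?_, fun i j => ?_⟩⟩
  · rw [div_lt_one (by positivity)]; linarith
  · exact key _ _ (hq q hq' i j) (hfl x hx i j)
  · exact key _ _ (hq q hq' i j) (hbB i j)

/-- The point `z / t`, moved slightly towards `q`. -/
noncomputable def push (q : Fin n → ℝ) (ε : ℝ) (t : ℕ) (z : Fin n → ℤ) : Fin n → ℝ :=
  ((t : ℝ) + ε)⁻¹ • ((fun i => (z i : ℝ)) + ε • q)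

variable {q : Fin n → ℝ} {ε : ℝ} {t : ℕ} {z : Fin n → ℤ}

lemma mul_dif_push (hε : 0 < ε) (i j : Fin (n + 1)) :
    (t + ε) * dif (push q ε t z) i j = dif (fun i => (z i : ℝ)) i j + ε * dif q i j := by
  have : (t : ℝ) + ε ≠ 0 := by positivity
  rw [push, dif_smul, dif_add, dif_smul, mul_inv_cancel_left₀ this]

lemma mul_lam_push (hε : 0 < ε) (C : Chart b x d) (k : Fin (d + 1)) :
    (t + ε) * C.lam (coord (push q ε t z)) 1 k =
      C.lam (coord fun i => (z i : ℝ)) t k + ε * C.lam (coord q) 1 k := by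
  have h : (t : ℝ) + ε ≠ 0 := by positivity
  rw [← C.lam_smul, ← C.lam_add_smul, mul_one, mul_one]
  congr 1
  funext i
  rw [push, coord_smul, coord_add, coord_smul, mul_inv_cancel_left₀ h]

lemma dif_intCast (z : Fin n → ℤ) (i j : Fin (n + 1)) :
    ∃ m : ℤ, dif (fun i => (z i : ℝ)) i j = m := by
  have h : ∀ i, ∃ m : ℤ, coord (fun i => (z i : ℝ)) i = m := fun i =>
    Fin.cases ⟨0, by simp⟩ (fun i => ⟨z i, by simp⟩) i
  obtain ⟨m, hm⟩ := h i
  obtain ⟨m', hm'⟩ := h j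
  exact ⟨m - m', by rw [dif, hm, hm']; push_cast; rfl⟩

lemma Chart.lam_intCast (C : Chart b x d) (z : Fin n → ℤ) (t : ℕ) (k : Fin (d + 1)) :
    ∃ m : ℤ, C.lam (coord fun i => (z i : ℝ)) t k = m := by
  obtain ⟨m, hm⟩ := dif_intCast z (C.σ (k + 1)) (C.σ k)
  rw [lam, ← dif, hm]
  refine ⟨m - t * (⌊coord x (C.σ (k + 1))⌋ - ⌊coord x (C.σ k)⌋) +
    if k = Fin.last d then (t : ℤ) else 0, ?_⟩
  split_ifs <;> push_cast <;> rfl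

/-- If a difference at the pushed point were an integer `l`, then `ε (q_i - q_j - l)` would be an
integer of absolute value below one, hence zero, and regularity of `q` applies. -/
lemma isReg_push (hq : IsReg b q) (hε : 0 < ε)
    (hsmall : ∀ x ∈ alc b, ∀ i j, ε * |dif q i j - fl x i j| < 1)
    (hz : ∀ i j, dif (fun i => (z i : ℝ)) i j ≤ t * b i j) : IsReg b (push q ε t z) := by
  have htε : (0 : ℝ) < t + ε := by positivity
  have hmem : push q ε t z ∈ alc b := by
    intro i j
    have h1 := mul_le_mul_of_nonneg_left (hq.1 i j) hε.le
    rw [← mul_le_mul_iff_right₀ htε, mul_dif_push hε]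
    linarith [hz i j]
  refine ⟨hmem, fun i j l hl => ?_⟩
  have h1 := mul_dif_push (q := q) (t := t) (z := z) hε i j
  have h2 := hsmall _ hmem i j
  rw [fl_of_dif_eq hl] at h2
  rw [hl] at h1
  obtain ⟨m, hm⟩ := dif_intCast z i j
  have h3 : ((m - t * l : ℤ) : ℝ) = -(ε * (dif q i j - l)) := by
    push_cast; rw [← hm]; linarith
  have h4 : |((m - t * l : ℤ) : ℝ)| < 1 := by
    rw [h3, abs_neg, abs_mul, abs_of_pos hε]; exact h2
  have h5 : m - t * l = 0 := by
    rw [← Int.cast_abs] at h4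
    exact Int.abs_lt_one_iff.1 (by exact_mod_cast h4)
  rw [h5, Int.cast_zero, eq_comm, neg_eq_zero, mul_eq_zero] at h3
  rcases h3 with h3 | h3
  · exact absurd h3 hε.ne'
  · exact hq.2 i j l (by linarith)

lemma abs_lam_lt (C : Chart b x d) (hx : x ∈ alc b) (hε : 0 < ε) (hε1 : ε < 1)
    (hsmall : ∀ x ∈ alc b, ∀ i j, ε * |dif q i j - fl x i j| < 1) (k : Fin (d + 1)) :
    |ε * C.lam (coord q) 1 k| < 1 := by
  rw [abs_mul, abs_of_pos hε]
  rcases Nat.eq_zero_or_pos d with hd | hd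
  · rw [C.lam_zero_dim hd]; simpa using hε1
  · rw [C.lam_eq_dif hd]; exact hsmall x hx _ _

/-- Lattice points of dilations are given by a simplex of the triangulation and barycentric
coordinates that are positive at the visible facets. -/
lemma latticeCount_alc [Fintype (alcovedTriangulation (alc b))]
    (C : ∀ F : alcovedTriangulation (alc b), Chart b (pnt F) d)
    (hq : IsReg b q) (t : ℕ) :
    latticeCount (alc b) t = ∑ F, (weights (visible (C F) q) t).card := by
  classical
  obtain ⟨ε, hε, hε1, hsmall⟩ := exists_small b
  obtain ⟨hsmall, hsmall'⟩ := hsmall q hq.1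
  have htε : (0 : ℝ) < t + ε := by positivity
  let Φ : (Σ _ : alcovedTriangulation (alc b), Fin (d + 1) →₀ ℕ) → Fin n → ℤ := fun p =>
    (C p.1).latticePoint t p.2
  let W : Finset (Σ _ : alcovedTriangulation (alc b), Fin (d + 1) →₀ ℕ) :=
    Finset.univ.sigma fun F => weights (visible (C F) q) t
  -- Up to a positive factor, a barycentric coordinate of the pushed point is the integer `l k` plus
  -- a term below one in absolute value, negative exactly at visible facets.
  have hcell : ∀ p ∈ W, push q ε t (Φ p) ∈ cell (pnt p.1) := by
    rintro ⟨F, l⟩ hp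
    obtain ⟨hsum, hvis⟩ := mem_weights.1 (Finset.mem_sigma.1 hp).2
    rw [(C F).mem_cell_iff (isReg_pnt F)]
    constructor
    · intro i j hij
      have h1 := mul_dif_push (q := q) (t := t) (z := Φ ⟨F, l⟩) hε i j
      rw [(C F).dif_latticePoint (isReg_pnt F).1 t l hij,
        cls_eq.1 hij _ hq.1 _ (isReg_pnt F).1, ← add_mul] at h1
      exact mul_left_cancel₀ htε.ne' h1
    · intro k
      have h1 := mul_lam_push (q := q) (t := t) (z := Φ ⟨F, l⟩) hε (C F) k
      rw [(C F).lam_latticePoint hsum] at h1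
      refine pos_of_mul_pos_right (a := (t : ℝ) + ε) ?_ htε.le
      rw [h1]
      by_cases hk : k ∈ visible (C F) q
      · have h2 : (1 : ℝ) ≤ l k := by exact_mod_cast hvis k hk
        have h3 := (abs_lt.1 (abs_lam_lt (C F) (isReg_pnt F).1 hε hε1 hsmall k)).1
        linarith
      · rw [mem_visible, not_lt] at hk
        have hne : (C F).lam (coord q) 1 k ≠ 0 := by
          rcases Nat.eq_zero_or_pos d with hd | hd
          · rw [(C F).lam_zero_dim hd]; exact one_ne_zero
          · exact (C F).lam_ne_zero hd hq k
        have : 0 < (C F).lam (coord q) 1 k := lt_of_le_of_ne hk hne.symm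
        positivity
  have himage : {z : Fin n → ℤ | (fun i => (z i : ℝ)) ∈ (t : ℝ) • alc b} = (W.image Φ : Finset _) := by
    ext z
    rw [Set.mem_ofPred_eq, mem_smul_alc ⟨q, hq.1⟩, Finset.mem_coe, Finset.mem_image]
    constructor
    · intro hz
      have hreg := isReg_push hq hε hsmall hz
      obtain ⟨F, hF⟩ := exists_pnt_fl_eq hreg
      have hmem : push q ε t z ∈ cell (pnt F) := mem_cell_iff.2 fun i j => (hF i j).symm
      obtain ⟨h1, h2⟩ := ((C F).mem_cell_iff (isReg_pnt F)).1 hmem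
      choose m hm using (C F).lam_intCast z t
      have hpos : ∀ k, (0 : ℝ) < m k + ε * (C F).lam (coord q) 1 k := by
        intro k
        rw [← hm, ← mul_lam_push hε]
        exact mul_pos htε (h2 k)
      have hm0 : ∀ k, 0 ≤ m k := by
        intro k
        have h3 := (abs_lt.1 (abs_lam_lt (C F) (isReg_pnt F).1 hε hε1 hsmall k)).2
        have h4 : (-1 : ℝ) < m k := by linarith [hpos k]
        have h5 : -1 < m k := by exact_mod_cast h4
        omega
      let l : Fin (d + 1) →₀ ℕ := Finsupp.equivFunOnFinite.symm fun k => (m k).toNat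
      have hl : ∀ k, (l k : ℝ) = m k := by
        intro k
        have : ((m k).toNat : ℤ) = m k := Int.toNat_of_nonneg (hm0 k)
        exact_mod_cast this
      have hsum : ∑ k, l k = t := by
        have := (C F).sum_lam (coord fun i => (z i : ℝ)) t
        simp only [hm, ← hl] at this
        exact_mod_cast this
      refine ⟨⟨F, l⟩, Finset.mem_sigma.2 ⟨Finset.mem_univ _, mem_weights.2 ⟨hsum, fun k hk => ?_⟩⟩, ?_⟩
      · rw [mem_visible] at hk
        have h3 := mul_neg_of_pos_of_neg hε hk
        have h4 : (0 : ℝ) < l k := by rw [hl]; linarith [hpos k]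
        exact_mod_cast h4
      · have : (fun i => ((C F).latticePoint t l i : ℝ)) = fun i => (z i : ℝ) := by
          refine (C F).eq_of_lam_eq (t := t) (fun i j hij => ?_) fun k => ?_
          · rw [(C F).dif_latticePoint (isReg_pnt F).1 t l hij]
            have h3 := mul_dif_push (q := q) (t := t) (z := z) hε i j
            rw [h1 i j hij, cls_eq.1 hij _ hq.1 _ (isReg_pnt F).1] at h3
            linarith
          · rw [(C F).lam_latticePoint hsum, hl, hm]
        funext i
        exact_mod_cast congrFun this i
    · rintro ⟨p, hp, rfl⟩ i j
      have h1 := (closure_cell_subset_alc.2 (isReg_pnt p.1).1) (subset_closure (hcell p hp)) i j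
      have h2 := mul_dif_push (q := q) (t := t) (z := Φ p) hε i j
      have h3 := mul_le_mul_of_nonneg_left h1 htε.le
      have h4 := hsmall' i j
      rw [abs_sub_comm] at h4
      have h5 := mul_le_mul_of_nonneg_left (le_abs_self (b i j - dif q i j : ℝ)) hε.le
      obtain ⟨m, hm⟩ := dif_intCast (Φ p) i j
      rw [hm] at h2 ⊢
      -- The pushed point lies in `alc b`, so the integral difference `m` can exceed its bound only
      -- by less than one, hence not at all.
      have h6 : (m : ℝ) < t * b i j + 1 := by linarith
      have h7 : m ≤ t * b i j := Int.lt_add_one_iff.1 (by exact_mod_cast h6)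
      exact_mod_cast h7
  -- The open cell containing the pushed point determines the simplex, and the barycentric
  -- coordinates then return the weights.
  have hinj : Set.InjOn Φ W := by
    rintro ⟨F, l⟩ hp ⟨F', l'⟩ hp' heq
    have h1 := hcell _ hp
    have h2 := hcell _ hp'
    rw [heq] at h1
    have hFF : F = F' := ext_fl_pnt fun i j =>
      (mem_cell_iff.1 h1 i j).symm.trans (mem_cell_iff.1 h2 i j)
    subst hFF
    have hl := (mem_weights.1 (Finset.mem_sigma.1 hp).2).1
    have hl' := (mem_weights.1 (Finset.mem_sigma.1 hp').2).1
    have : l = l' := by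
      ext k
      have h3 := (C F).lam_latticePoint hl k
      have h4 := (C F).lam_latticePoint hl' k
      have heq' : (C F).latticePoint t l = (C F).latticePoint t l' := heq
      rw [heq', h4] at h3
      exact_mod_cast h3.symm
    rw [this]
  rw [latticeCount, himage, Set.ncard_coe_finset, Finset.card_image_of_injOn hinj,
    Finset.card_sigma]

/-- The main theorem for sets given by integral bounds on coordinate differences. -/
theorem hStar_alc (b : Fin (n + 1) → Fin (n + 1) → ℤ) (F₀ : alcovedTriangulation (alc b)) (k : ℕ) :
    hStar (alc b) k = ({F : alcovedTriangulation (alc b) |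
      {F' | (orientAway (dualGraph (alcovedTriangulation (alc b))) F₀).Adj F' F}.encard = k}.ncard :
        ℤ) := by
  classical
  have hfin := (finite_alcovedTriangulation b).fintype
  obtain ⟨d, hd⟩ : ∃ d, Fintype.card (Cls b) = d + 1 :=
    ⟨_, (Nat.succ_pred_eq_of_pos (Fintype.card_pos_iff.2 ⟨cls b 0⟩)).symm⟩
  have hC : ∀ F : alcovedTriangulation (alc b), Nonempty (Chart b (pnt F) d) := fun F =>
    (isReg_pnt F).nonempty_chart hd
  let C := fun F => (hC F).some
  have hdim : (polyDim (alc b) + 1).toNat = d + 1 := by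
    rw [(isReg_pnt F₀).polyDim_eq, hd]; rfl
  have hser : ehrhartSeries (alc b) = ∑ F : alcovedTriangulation (alc b),
      PowerSeries.mk fun t => ((weights (visible (C F) (pnt F₀)) t).card : ℤ) := by
    ext t
    rw [ehrhartSeries, PowerSeries.coeff_mk, latticeCount_alc C (isReg_pnt F₀), map_sum]
    simp
  rw [hStar, hdim, hser, Finset.mul_sum, map_sum]
  simp only [one_sub_X_pow_mul_weights, PowerSeries.coeff_X_pow, Finset.sum_boole]
  simp only [encard_incoming hd F₀ _ (C _)]
  rw [← Set.ncard_coe_finset]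
  congr 2
  ext F
  simp [eq_comm]

end Counting

/-! ### Facets of general polytopes -/

section Facets

variable {E : Type*} [NormedAddCommGroup E] [NormedSpace ℝ E]

/-- The last point of a segment that lies in a compact convex set. -/
lemma exists_exit_point {P : Set E} (hP : IsCompact P) {x y : E}
    (hx : x ∉ P) (hy : y ∈ interior P) :
    ∃ s : ℝ, 0 < s ∧ s < 1 ∧ y + s • (x - y) ∈ P ∧ y + s • (x - y) ∉ interior P := by
  have hcont : Continuous fun s : ℝ => y + s • (x - y) := by fun_prop
  set T : Set ℝ := Set.Icc 0 1 ∩ (fun s : ℝ => y + s • (x - y)) ⁻¹' P with hT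
  have hTc : IsCompact T := isCompact_Icc.inter_right (hP.isClosed.preimage hcont)
  have hT0 : (0 : ℝ) ∈ T := ⟨by simp, by simpa using interior_subset hy⟩
  obtain ⟨s, hsT, hsmax⟩ := hTc.exists_isGreatest ⟨0, hT0⟩
  have hs1 : s ≠ 1 := by
    rintro rfl
    have := hsT.2
    simp at this
    exact hx this
  have hs1' : s < 1 := lt_of_le_of_ne hsT.1.2 hs1
  have hnot : y + s • (x - y) ∉ interior P := by
    intro hmem
    have h1 : ∀ᶠ r in nhdsWithin s (Set.Ioi s), y + r • (x - y) ∈ P :=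
      ((hcont.tendsto s).eventually (isOpen_interior.mem_nhds hmem)).filter_mono
        nhdsWithin_le_nhds |>.mono fun r hr => interior_subset hr
    have h2 : ∀ᶠ r in nhdsWithin s (Set.Ioi s), r ∈ Set.Ioo s 1 := Ioo_mem_nhdsGT hs1'
    obtain ⟨r, hr, hr'⟩ := (h1.and h2).exists
    have := hsmax ⟨⟨hsT.1.1.trans hr'.1.le, hr'.2.le⟩, hr⟩
    exact absurd hr'.1 (not_lt.2 this)
  refine ⟨s, lt_of_le_of_ne hsT.1.1 ?_, hs1', hsT.2, hnot⟩
  rintro rfl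
  exact hnot (by simpa using hy)

/-- The part of a polytope in a supporting hyperplane is the hull of the generators in it. -/
lemma face_subset_convexHull {V : Set E} (hV : V.Finite) (f : StrongDual ℝ E) {r : ℝ}
    (hf : ∀ y ∈ convexHull ℝ V, f y ≤ r) :
    convexHull ℝ V ∩ {y | f y = r} ⊆ convexHull ℝ (V ∩ {y | f y = r}) := by
  set P := convexHull ℝ V with hP
  have hexp : IsExposed ℝ P (P ∩ {y | f y = r}) := by
    rintro ⟨z, hz, hzr⟩
    refine ⟨f, ?_⟩
    ext w
    constructor
    · rintro ⟨hw, hwr⟩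
      exact ⟨hw, fun y hy => (hf y hy).trans (le_of_eq hwr.symm)⟩
    · rintro ⟨hw, hmax⟩
      exact ⟨hw, le_antisymm (hf w hw) (hzr ▸ hmax z hz)⟩
  have hcomp : IsCompact (P ∩ {y | f y = r}) :=
    (hV.isCompact_convexHull ℝ).inter_right (isClosed_eq f.continuous continuous_const)
  have hconv : Convex ℝ (P ∩ {y | f y = r}) :=
    (convex_convexHull ℝ V).inter (convex_hyperplane f.toLinearMap.isLinear r)
  -- Krein–Milman: the extreme points of the face are extreme in the polytope, hence belong to `V`.
  rw [← closure_convexHull_extremePoints hcomp hconv]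
  refine closure_minimal (convexHull_mono fun w hw => ?_)
    ((hV.subset Set.inter_subset_left).isCompact_convexHull ℝ).isClosed
  exact ⟨extremePoints_convexHull_subset (hexp.isExtreme.extremePoints_subset_extremePoints hw),
    hw.1.2⟩

variable [FiniteDimensional ℝ E]

/-- An open set contains a point outside finitely many proper affine subspaces. -/
lemma exists_mem_open_notMem {ι : Type*} {s : Set ι} (hs : s.Finite) (A : ι → AffineSubspace ℝ E)
    (hA : ∀ i ∈ s, A i ≠ ⊤) {U : Set E} (hU : IsOpen U) (hne : U.Nonempty) :
    ∃ y ∈ U, ∀ i ∈ s, y ∉ A i := by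
  let _ : MeasurableSpace E := borel E
  have : BorelSpace E := ⟨rfl⟩
  let μ : MeasureTheory.Measure E := MeasureTheory.Measure.addHaar
  by_contra! hcon
  have hsub : U ⊆ ⋃ i ∈ s, (A i : Set E) := fun y hy => by
    obtain ⟨i, hi, hy⟩ := hcon y hy
    exact Set.mem_biUnion hi hy
  have h0 : μ (⋃ i ∈ s, (A i : Set E)) = 0 :=
    (MeasureTheory.measure_biUnion_null_iff hs.countable).2 fun i hi =>
      MeasureTheory.Measure.addHaar_affineSubspace μ _ (hA i hi)
  exact (hU.measure_pos μ hne).ne' (MeasureTheory.measure_mono_null hsub h0)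

/-- Every point outside a full-dimensional polytope is strictly separated from it by a
facet-defining hyperplane. -/
lemma exists_facet {V : Set E} (hV : V.Finite) (hint : (interior (convexHull ℝ V)).Nonempty)
    {x : E} (hx : x ∉ convexHull ℝ V) : ∃ (f : StrongDual ℝ E) (r : ℝ),
      (∀ y ∈ convexHull ℝ V, f y ≤ r) ∧ (∃ y ∈ convexHull ℝ V, f y < r) ∧ r < f x ∧
      (convexHull ℝ V ∩ {y | f y = r}).Nonempty ∧
      Module.finrank ℝ E ≤
        Module.finrank ℝ (vectorSpan ℝ (convexHull ℝ V ∩ {y | f y = r})) + 1 := by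
  have hconv := convex_convexHull ℝ V
  -- A generic interior point: the segment from `y` to `x` must not leave the polytope through a
  -- face of dimension less than that of a facet.
  obtain ⟨y, hy, hgen⟩ := exists_mem_open_notMem
    (s := {T | T ⊆ V ∧ Module.finrank ℝ (vectorSpan ℝ T) + 1 < Module.finrank ℝ E})
    (hV.finite_subsets.subset fun T hT => hT.1) (fun T => affineSpan ℝ (insert x T))
    (fun T hT htop => by
      have h1 := finrank_vectorSpan_insert_le_set ℝ T x
      rw [← direction_affineSpan, htop, AffineSubspace.direction_top, finrank_top] at h1
      have := hT.2
      omega) isOpen_interior hint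
  obtain ⟨s, hs0, hs1, hzP, hzI⟩ := exists_exit_point (hV.isCompact_convexHull ℝ) hx hy
  set z := y + s • (x - y) with hz
  obtain ⟨f, hf⟩ := geometric_hahn_banach_open_point hconv.interior isOpen_interior hzI
  have hfz : f z = f y + s * (f x - f y) := by simp [hz]
  have hfP : ∀ w ∈ convexHull ℝ V, f w ≤ f z := by
    intro w hw
    have hcl := hconv.closure_interior_eq_closure_of_nonempty_interior hint
    have hw' : w ∈ closure (interior (convexHull ℝ V)) := hcl ▸ subset_closure hw
    exact closure_minimal (fun a ha => (hf a ha).le)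
      (isClosed_le f.continuous continuous_const) hw'
  have hfy := hf y hy
  have hfx : f z < f x := by nlinarith
  refine ⟨f, f z, hfP, ⟨y, interior_subset hy, hfy⟩, hfx, ⟨z, hzP, rfl⟩, ?_⟩
  set T := V ∩ {w | f w = f z} with hT
  have hzT : z ∈ convexHull ℝ T := face_subset_convexHull hV f hfP ⟨hzP, rfl⟩
  have hTdim : Module.finrank ℝ E ≤ Module.finrank ℝ (vectorSpan ℝ T) + 1 := by
    by_contra! hlt
    refine hgen T ⟨Set.inter_subset_left, hlt⟩ ?_
    have hxA : x ∈ affineSpan ℝ (insert x T) := mem_affineSpan ℝ (Set.mem_insert _ _)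
    have hzA : z ∈ affineSpan ℝ (insert x T) :=
      affineSpan_mono ℝ (Set.subset_insert x T) (convexHull_subset_affineSpan T hzT)
    -- As `z - x = (1 - s) (y - x)`, the point `y` lies on the line through `x` and `z`, against the
    -- choice of `y`.
    have hline := AffineMap.lineMap_mem (1 - s)⁻¹ hxA hzA
    convert hline using 1
    have h1 : 1 - s ≠ 0 := by linarith
    have h2 : z - x = (1 - s) • (y - x) := by rw [hz]; module
    rw [AffineMap.lineMap_apply_module', h2, smul_smul, inv_mul_cancel₀ h1, one_smul,
      sub_add_cancel]
  have hmono : vectorSpan ℝ T ≤ vectorSpan ℝ (convexHull ℝ V ∩ {w | f w = f z}) :=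
    vectorSpan_mono ℝ (Set.inter_subset_inter_left _ (subset_convexHull ℝ V))
  have := Submodule.finrank_mono hmono
  omega

/-- The upper bound for the dimension of a proper face. -/
lemma finrank_face_lt {P : Set E} {f : E →ₗ[ℝ] ℝ} {r : ℝ} (h1 : ∃ y ∈ P, f y < r)
    (h2 : (P ∩ {y | f y = r}).Nonempty) :
    Module.finrank ℝ (vectorSpan ℝ (P ∩ {y | f y = r})) < Module.finrank ℝ (vectorSpan ℝ P) := by
  obtain ⟨y, hy, hyr⟩ := h1
  obtain ⟨z, hz, hzr⟩ := h2
  refine Submodule.finrank_lt_finrank_of_lt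
    (lt_of_le_of_ne (vectorSpan_mono ℝ Set.inter_subset_left) fun e => ?_)
  have hle : vectorSpan ℝ (P ∩ {y | f y = r}) ≤ LinearMap.ker f := by
    rw [vectorSpan_def, Submodule.span_le]
    rintro _ ⟨a, ha, c, hc, rfl⟩
    have ha' : f a = r := ha.2
    have hc' : f c = r := hc.2
    simp [ha', hc']
  rw [e] at hle
  have h3 : f (y - z) = 0 := hle (vsub_mem_vectorSpan ℝ hy hz)
  have hzr' : f z = r := hzr
  rw [map_sub, hzr'] at h3
  linarith

/-- Polytopes of positive dimension have a facet. -/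
lemma exists_facet_of_pos {V : Set E} (hV : V.Finite) (hne : V.Nonempty)
    (hpos : 0 < Module.finrank ℝ (vectorSpan ℝ (convexHull ℝ V))) : ∃ (f : E →ₗ[ℝ] ℝ) (r : ℝ),
      (∀ y ∈ convexHull ℝ V, f y ≤ r) ∧ (∃ y ∈ convexHull ℝ V, f y < r) ∧
      (convexHull ℝ V ∩ {y | f y = r}).Nonempty ∧
      Module.finrank ℝ (vectorSpan ℝ (convexHull ℝ V ∩ {y | f y = r})) + 1 =
        Module.finrank ℝ (vectorSpan ℝ (convexHull ℝ V)) := by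
  set L := vectorSpan ℝ (convexHull ℝ V) with hL
  -- Projecting to the direction space makes the polytope full-dimensional, so that `exists_facet`
  -- applies there.
  obtain ⟨π, hπ⟩ := L.subtype.exists_leftInverse_of_injective L.ker_subtype
  have hπL : Submodule.map π L = ⊤ := by
    rw [eq_top_iff]
    rintro v -
    exact ⟨v, v.2, LinearMap.congr_fun hπ v⟩
  have himg : π '' convexHull ℝ V = convexHull ℝ (π '' V) := π.image_convexHull V
  have hspan : ∀ S : Set E, vectorSpan ℝ (π '' S) = Submodule.map π (vectorSpan ℝ S) := fun S =>
    (AffineMap.map_vectorSpan π.toAffineMap (s := S)).symm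
  have hint : (interior (convexHull ℝ (π '' V))).Nonempty := by
    rw [(convex_convexHull ℝ _).interior_nonempty_iff_affineSpan_eq_top, ← himg,
      AffineSubspace.affineSpan_eq_top_iff_vectorSpan_eq_top_of_nonempty ℝ _ _
        ((hne.mono (subset_convexHull ℝ V)).image _), hspan, hπL]
  have : Nontrivial L := Module.finrank_pos_iff.1 hpos
  have : NoncompactSpace L := NormedSpace.noncompactSpace ℝ L
  obtain ⟨x, hx⟩ := (Set.ne_univ_iff_exists_notMem _).1
    ((hV.image π).isCompact_convexHull ℝ).ne_univ
  obtain ⟨f, r, h1, ⟨y, hy, hyr⟩, -, ⟨z, hz, hzr⟩, h4⟩ := exists_facet (hV.image π) hint hx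
  rw [← himg] at h1 hy hz h4
  obtain ⟨y, hy, rfl⟩ := hy
  obtain ⟨z, hz, rfl⟩ := hz
  have hex : ∃ y ∈ convexHull ℝ V, (f.toLinearMap ∘ₗ π) y < r := ⟨y, hy, hyr⟩
  have hne' : (convexHull ℝ V ∩ {y | (f.toLinearMap ∘ₗ π) y = r}).Nonempty := ⟨z, hz, hzr⟩
  refine ⟨f.toLinearMap ∘ₗ π, r, fun w hw => h1 _ ⟨w, hw, rfl⟩, hex, hne', ?_⟩
  have hlt := finrank_face_lt hex hne'
  have himg' : π '' convexHull ℝ V ∩ {y | f y = r} =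
      π '' (convexHull ℝ V ∩ {y | (f.toLinearMap ∘ₗ π) y = r}) := by
    ext w
    constructor
    · rintro ⟨⟨v, hv, rfl⟩, hr⟩
      exact ⟨v, ⟨hv, hr⟩, rfl⟩
    · rintro ⟨v, ⟨hv, hr⟩, rfl⟩
      exact ⟨⟨v, hv, rfl⟩, hr⟩
  rw [himg', hspan] at h4
  have h5 := Submodule.finrank_map_le π
    (vectorSpan ℝ (convexHull ℝ V ∩ {y | (f.toLinearMap ∘ₗ π) y = r}))
  rw [← hL] at hlt
  omega

end Facets

/-! ### Reduction to integral bounds on coordinate differences -/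

section Reduction

variable {n : ℕ}

lemma exists_dotProduct (f : (Fin n → ℝ) →ₗ[ℝ] ℝ) : ∃ a : Fin n → ℝ, ∀ x, a ⬝ᵥ x = f x :=
  ⟨(dotProductEquiv ℝ (Fin n)).symm f, fun x =>
    LinearMap.congr_fun ((dotProductEquiv ℝ (Fin n)).apply_symm_apply f) x⟩

lemma isFacetDefining_of_le {P : Set (Fin n → ℝ)} {f : (Fin n → ℝ) →ₗ[ℝ] ℝ} {r : ℝ} (hf : f ≠ 0)
    (hle : ∀ y ∈ P, f y ≤ r) (hdim : polyDim ({x | f x = r} ∩ P) = polyDim P - 1) :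
    IsFacetDefining P {x | f x = r} := by
  obtain ⟨a, ha⟩ := exists_dotProduct f
  refine ⟨⟨a, r, fun h => hf (LinearMap.ext fun x => ?_), ?_, Or.inl fun x hx => ?_⟩, hdim⟩
  · rw [← ha, h, zero_dotProduct, LinearMap.zero_apply]
  · simp only [ha]
  · rw [ha]; exact hle x hx

/-- The functional and the right-hand side of a facet of a polytope, where the empty facet of a
point is allowed. -/
lemma exists_face {V : Set (Fin n → ℝ)} (hV : V.Finite) (hne : V.Nonempty) :
    ∃ (f : (Fin n → ℝ) →ₗ[ℝ] ℝ) (r : ℝ), (∀ y ∈ convexHull ℝ V, f y ≤ r) ∧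
      (∃ y ∈ convexHull ℝ V, f y < r) ∧
      (f = 0 ∨ ∃ y ∈ convexHull ℝ V, f y = r) ∧
      polyDim (convexHull ℝ V ∩ {y | f y = r}) = polyDim (convexHull ℝ V) - 1 := by
  have hPne : (convexHull ℝ V).Nonempty := hne.mono (subset_convexHull ℝ V)
  rcases Nat.eq_zero_or_pos (Module.finrank ℝ (vectorSpan ℝ (convexHull ℝ V))) with h0 | hpos
  · obtain ⟨y, hy⟩ := hPne
    -- For a point, `0 = 1` cuts out the empty facet, of dimension `-1`.
    refine ⟨0, 1, fun _ _ => by simp, ⟨y, hy, by simp⟩, Or.inl rfl, ?_⟩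
    have hemp : ¬(convexHull ℝ V ∩ {y | (0 : (Fin n → ℝ) →ₗ[ℝ] ℝ) y = 1}).Nonempty := by
      rintro ⟨z, -, hz⟩
      exact zero_ne_one hz
    rw [polyDim_of_nonempty ⟨y, hy⟩, h0, polyDim, if_neg hemp]
    rfl
  · obtain ⟨f, r, h1, h2, h3, h4⟩ := exists_facet_of_pos hV hne hpos
    refine ⟨f, r, h1, h2, Or.inr ?_, ?_⟩
    · obtain ⟨z, hz, hzr⟩ := h3
      exact ⟨z, hz, hzr⟩
    · rw [polyDim_of_nonempty h3, polyDim_of_nonempty hPne, ← h4]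
      push_cast
      ring

lemma exists_apply_ne_zero {f g : (Fin n → ℝ) →ₗ[ℝ] ℝ} (hf : f ≠ 0) (hg : g ≠ 0) :
    ∃ u, f u ≠ 0 ∧ g u ≠ 0 := by
  obtain ⟨u, hu⟩ := DFunLike.ne_iff.1 hf
  obtain ⟨v, hv⟩ := DFunLike.ne_iff.1 hg
  by_cases h1 : g u = 0
  · by_cases h2 : f v = 0
    · exact ⟨u + v, by simpa [h2] using hu, by simpa [h1] using hv⟩
    · exact ⟨v, h2, hv⟩
  · exact ⟨u, hu, h1⟩

/-- The hyperplanes of a polytope that is not full-dimensional are not all in the arrangement. -/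
lemma vectorSpan_eq_top {V : Set (Fin n → ℝ)} (hV : V.Finite) (hne : V.Nonempty)
    (h : ∀ H, IsFacetDefining (convexHull ℝ V) H →
      ∃ (i j : Fin (n + 1)) (l : ℤ), i ≠ j ∧ H = hyp i j l) :
    vectorSpan ℝ (convexHull ℝ V) = ⊤ := by
  by_contra hL
  set P := convexHull ℝ V with hP
  -- A nonzero functional that is constant on `P`: adding multiples of it to a facet functional
  -- tilts the hyperplane without changing its intersection with `P`.
  obtain ⟨c, hc0, hcL⟩ := Submodule.exists_le_ker_of_lt_top _ (lt_top_iff_ne_top.2 hL)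
  obtain ⟨f, r, h1, ⟨y, hy, hyr⟩, h3, h4⟩ := exists_face hV hne
  set e := c y with he
  have hce : ∀ z ∈ P, c z = e := by
    intro z hz
    have : c (z - y) = 0 := hcL (vsub_mem_vectorSpan ℝ hz hy)
    rwa [map_sub, sub_eq_zero] at this
  have hg0 : ∀ ε : ℝ, 0 < ε → f + ε • c ≠ 0 := by
    intro ε hε h0
    rcases h3 with rfl | ⟨z, hz, hzr⟩
    · rw [zero_add, smul_eq_zero] at h0
      exact h0.elim hε.ne' hc0
    · have e1 := LinearMap.congr_fun h0 y
      have e2 := LinearMap.congr_fun h0 z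
      simp only [LinearMap.add_apply, LinearMap.smul_apply, smul_eq_mul, LinearMap.zero_apply,
        hce z hz, hzr] at e1 e2
      linarith
  let H : ℝ → Set (Fin n → ℝ) := fun ε => {x | (f + ε • c) x = r + ε * e}
  have hH : ∀ ε, 0 < ε → IsFacetDefining P (H ε) := by
    intro ε hε
    refine isFacetDefining_of_le (hg0 ε hε) (fun z hz => ?_) ?_
    · simp only [LinearMap.add_apply, LinearMap.smul_apply, smul_eq_mul, hce z hz]
      linarith [h1 z hz]
    · rw [← h4]
      congr 1
      ext z
      simp only [Set.mem_inter_iff, Set.mem_ofPred_eq, LinearMap.add_apply, LinearMap.smul_apply,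
        smul_eq_mul]
      constructor
      · rintro ⟨hz, hzP⟩
        rw [hce z hzP] at hz
        exact ⟨hzP, by linarith⟩
      · rintro ⟨hzP, hz⟩
        rw [hce z hzP, hz]
        exact ⟨rfl, hzP⟩
  have hinj : Set.InjOn H (Set.Ioi 0) := by
    intro ε hε ε' _ heq
    -- Moving from `y` along `u` reaches a point of `H ε` where `c` differs from `e`; such a point
    -- lies on only one of the hyperplanes.
    obtain ⟨u, hu1, hu2⟩ := exists_apply_ne_zero (hg0 ε hε) hc0
    set s := (r - f y) / (f + ε • c) u with hs
    have hs0 : s ≠ 0 := div_ne_zero (sub_ne_zero.2 hyr.ne') hu1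
    have hsu : s * (f u + ε * c u) = r - f y := div_mul_cancel₀ _ hu1
    have hw : y + s • u ∈ H ε := by
      change f (y + s • u) + ε * c (y + s • u) = r + ε * e
      simp only [map_add, map_smul, smul_eq_mul]
      linear_combination hsu + ε * he
    have hw' : y + s • u ∈ H ε' := heq ▸ hw
    have hw1 : f (y + s • u) + ε * c (y + s • u) = r + ε * e := hw
    have hw2 : f (y + s • u) + ε' * c (y + s • u) = r + ε' * e := hw'
    have hcw : c (y + s • u) - e ≠ 0 := by
      simp only [map_add, map_smul, smul_eq_mul, ← he, add_sub_cancel_left]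
      exact mul_ne_zero hs0 hu2
    have : (ε - ε') * (c (y + s • u) - e) = 0 := by linear_combination hw1 - hw2
    exact sub_eq_zero.1 ((mul_eq_zero.1 this).resolve_right hcw)
  have hcount : (H '' Set.Ioi 0).Countable := by
    refine (Set.countable_range fun p : Fin (n + 1) × Fin (n + 1) × ℤ =>
      (hyp p.1 p.2.1 p.2.2 : Set (Fin n → ℝ))).mono ?_
    rintro _ ⟨ε, hε, rfl⟩
    obtain ⟨i, j, l, -, hl⟩ := h _ (hH ε hε)
    exact ⟨(i, j, l), hl.symm⟩
  have := Set.countable_of_injective_of_countable_image hinj hcount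
  rw [← Cardinal.le_aleph0_iff_set_countable, Cardinal.mk_Ioi_real] at this
  exact absurd Cardinal.aleph0_lt_continuum (not_lt.2 this)

/-- A full-dimensional polytope whose facet-defining hyperplanes belong to the arrangement is
described by integral bounds on coordinate differences. -/
lemma exists_eq_alc_of_facets {V : Set (Fin n → ℝ)} (hV : V.Finite) (hne : V.Nonempty)
    (h : ∀ H, IsFacetDefining (convexHull ℝ V) H →
      ∃ (i j : Fin (n + 1)) (l : ℤ), i ≠ j ∧ H = hyp i j l) :
    ∃ b, convexHull ℝ V = alc b := by
  set P := convexHull ℝ V with hP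
  have htop := vectorSpan_eq_top hV hne h
  have hPne : P.Nonempty := hne.mono (subset_convexHull ℝ V)
  have hint : (interior P).Nonempty := by
    rw [(convex_convexHull ℝ _).interior_nonempty_iff_affineSpan_eq_top,
      AffineSubspace.affineSpan_eq_top_iff_vectorSpan_eq_top_of_nonempty ℝ _ _ hPne, htop]
  have hcomp : IsCompact P := hV.isCompact_convexHull ℝ
  -- The least integral bounds that hold on `P`; minimality is used against a separating facet.
  have hbd : ∀ i j, ∃ m : ℤ, (∀ p ∈ P, dif p i j ≤ m) ∧
      ∀ l : ℤ, (∀ p ∈ P, dif p i j ≤ l) → m ≤ l := by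
    intro i j
    refine Int.exists_least_of_bdd ?_ ?_
    · obtain ⟨p, hp⟩ := hPne
      exact ⟨fl p i j, fun z hz => by exact_mod_cast (fl_le p i j).trans (hz p hp)⟩
    · obtain ⟨B, hB⟩ := hcomp.bddAbove_image (continuous_dif i j).continuousOn
      exact ⟨⌈B⌉, fun p hp => (hB ⟨p, hp, rfl⟩).trans (Int.le_ceil B)⟩
  choose b hb1 hb2 using hbd
  refine ⟨b, Set.Subset.antisymm (fun p hp i j => hb1 i j p hp) fun x hx => ?_⟩
  by_contra hxP
  obtain ⟨f, r, h1, ⟨y, hy, hyr⟩, hfx, h3, h4⟩ := exists_facet hV hint hxP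
  have hf0 : f.toLinearMap ≠ 0 := by
    intro h0
    have e1 : f y = 0 := LinearMap.congr_fun h0 y
    have e2 : f x = 0 := LinearMap.congr_fun h0 x
    linarith
  have hlt : Module.finrank ℝ (vectorSpan ℝ (P ∩ {y | f y = r})) <
      Module.finrank ℝ (vectorSpan ℝ P) := finrank_face_lt (f := f.toLinearMap) ⟨y, hy, hyr⟩ h3
  rw [← hP] at h4
  have hfull : Module.finrank ℝ (vectorSpan ℝ P) = Module.finrank ℝ (Fin n → ℝ) := by
    rw [htop, finrank_top]
  have hdim : polyDim ({y | f y = r} ∩ P) = polyDim P - 1 := by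
    rw [Set.inter_comm, polyDim_of_nonempty (S := P ∩ {y | f y = r}) h3, polyDim_of_nonempty hPne]
    omega
  obtain ⟨i, j, l, -, hl⟩ :=
    h {x | f x = r} (isFacetDefining_of_le (f := f.toLinearMap) hf0 h1 hdim)
  have hiff : ∀ w, f w = r ↔ dif w i j = l := fun w => Set.ext_iff.1 hl w
  -- the segment from `p` to `x` crosses the hyperplane
  have hcross : ∀ p ∈ P, ∃ s : ℝ, 0 ≤ s ∧ s < 1 ∧ (1 - s) * dif p i j + s * dif x i j = l := by
    intro p hp
    have hpr := h1 p hp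
    have hpos : 0 < f x - f p := by linarith
    refine ⟨(r - f p) / (f x - f p), by apply div_nonneg <;> linarith,
      by rw [div_lt_one hpos]; linarith, ?_⟩
    rw [← dif_smul, ← dif_smul, ← dif_add, ← hiff]
    simp only [map_add, map_smul, smul_eq_mul]
    field_simp
    ring
  have hxl : dif x i j ≠ l := fun e => hfx.ne' ((hiff x).2 e)
  -- All of `P` lies on the side of the facet hyperplane opposite to `x`, so the least bound is
  -- already violated at `x`.
  rcases lt_or_gt_of_ne hxl with hx1 | hx1
  · have : b j i ≤ -l := by
      refine hb2 j i _ fun p hp => ?_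
      obtain ⟨s, hs0, hs1, hs⟩ := hcross p hp
      rw [dif_comm]
      push_cast
      nlinarith
    have h6 : (b j i : ℝ) ≤ -l := by exact_mod_cast this
    have h7 := hx j i
    rw [dif_comm] at h7
    linarith
  · have : b i j ≤ l := by
      refine hb2 i j _ fun p hp => ?_
      obtain ⟨s, hs0, hs1, hs⟩ := hcross p hp
      nlinarith
    have h6 : (b i j : ℝ) ≤ l := by exact_mod_cast this
    have h7 := hx i j
    linarith

/-- In the second alternative, a lower bound for `(j, i)` is an upper bound for `(i, j)`, so taking
minima leaves upper bounds only. -/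
lemma exists_eq_alc {P : Set (Fin n → ℝ)} (hP : IsAlcovedPolytope P) (hne : P.Nonempty) :
    ∃ b, P = alc b := by
  obtain ⟨⟨V, hV, rfl⟩, h | ⟨a, b, h⟩⟩ := hP
  · exact exists_eq_alc_of_facets hV (convexHull_nonempty_iff.1 hne) h
  · refine ⟨fun i j => min (b i j) (-a j i), h.trans ?_⟩
    ext x
    simp only [alc, dif, Set.mem_ofPred_eq, Int.cast_min, le_min_iff, forall_and]
    refine ⟨fun hx => ⟨hx.2, fun i j => ?_⟩, fun hx => ⟨fun i j => ?_, hx.1⟩⟩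
    · have := hx.1 j i
      push_cast
      linarith
    · have := hx.2 j i
      push_cast at this
      linarith

end Reduction

end Alcoved

theorem mainTheorem3 {n : ℕ} (P : Set (Fin n → ℝ)) (hP : Alcoved.IsAlcovedPolytope P)
    (F₀ : Alcoved.alcovedTriangulation P) :
    (Alcoved.alcovedTriangulation P).Finite ∧
    ∀ k : ℕ, Alcoved.hStar P k =
      ({F : Alcoved.alcovedTriangulation P |
        {F' | (Alcoved.orientAway (Alcoved.dualGraph (Alcoved.alcovedTriangulation P)) F₀).Adj
          F' F}.encard = k}.ncard : ℤ) := by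
  have hne : P.Nonempty := by
    obtain ⟨x, hx, hsub, -⟩ := F₀.2
    exact ⟨x, hsub (hx ▸ subset_closure (Alcoved.self_mem_cell x))⟩
  obtain ⟨b, rfl⟩ := Alcoved.exists_eq_alc hP hne
  exact ⟨Alcoved.finite_alcovedTriangulation b, Alcoved.hStar_alc b F₀⟩
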